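/- Let ${\mathbb S}^2=\{\theta\in{\mathbb R}^3: |\theta|=1\}$ with its round metric, Laplace–Beltrami operator $\Delta_{{\mathbb S}^2}$, geodesic distance $d$ and surface measure $d\sigma$, and let ${\mathbf n}=(0,0,1)$, ${\mathbf s}=(0,0,-1)$. "Axially symmetric" means rotationally symmetric about the line through ${\mathbf n}$ and ${\mathbf s}$. (a) Let $K$ and $f$ be continuous, non-negative, axially symmetric functions on ${\mathbb S}^2\setminus\{{\mathbf n}\}$ such that, for any $\theta,\theta'\in{\mathbb S}^2\setminus\{{\mathbf n}\}$ on the same geodesic (great circle) passing through ${\mathbf n}$ and ${\mathbf s}$, $K(\theta)\ge K(\theta')$ and $f(\theta)\ge f(\theta')$ whenever $\theta_3>\theta_3'$. Assume that $K$ and $f$ are not both constant on ${\mathbb S}^2\setminus\{{\mathbf n}\}$. Then every $v\in C^2({\mathbb S}^2\setminus\{{\mathbf n}\})$ with $$-\Delta_{{\mathbb S}^2}v+1=K(\theta)e^{2v}+f(\theta)\quad\text{on } {\mathbb S}^2\setminus\{{\mathbf n}\}\qquad\text{and}\qquad \limsup_{\theta\to{\mathbf n}}\frac{v(\theta)}{\log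 d(\theta,{\mathbf n})}\le 0$$ is axially symmetric. (b) If $0<\alpha<8\pi$ and $\gamma\ge 0$, then every $\varphi\in C^2({\mathbb S}^2)$ satisfying the mean field equation $$\Delta_{{\mathbb S}^2}\varphi+\frac{\exp(\alpha\varphi(\theta)-\gamma\langle{\mathbf s},\theta\rangle)}{\int_{{\mathbb S}^2}\exp(\alpha\varphi(\sigma)-\gamma\langle{\mathbf s},\sigma\rangle)\,d\sigma}-\frac1{4\pi}=0\quad\text{on } {\mathbb S}^2$$ is axially symmetric. -/

import Mathlib

open Set Filter Topology MeasureTheory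
open scoped Manifold ContDiff RealInnerProductSpace

noncomputable section

/-- Three-dimensional Euclidean space. -/
abbrev E3 : Type := EuclideanSpace ℝ (Fin 3)

/-- The standard unit sphere in `E3`, with Mathlib's smooth structure. -/
abbrev S2 : Type := Metric.sphere (0 : E3) 1

/-- The coordinates of a point of the sphere satisfy `θ₀² + θ₁² + θ₂² = 1`. -/
lemma S2.sq_sum (θ : S2) :
    (θ : E3) 0 ^ 2 + (θ : E3) 1 ^ 2 + (θ : E3) 2 ^ 2 = 1 := by
  have h : ‖(θ : E3)‖ = 1 := by simp
  have h2 := EuclideanSpace.real_norm_sq_eq (θ : E3)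
  rw [h, Fin.sum_univ_three] at h2
  linarith

/-- The north pole `(0, 0, 1)`. -/
def northPole : S2 :=
  ⟨!₂[(0 : ℝ), 0, 1], by
    rw [mem_sphere_zero_iff_norm, EuclideanSpace.norm_eq, Fin.sum_univ_three]; simp⟩

/-- The south pole `(0, 0, -1)`. -/
def southPole : S2 :=
  ⟨!₂[(0 : ℝ), 0, -1], by
    rw [mem_sphere_zero_iff_norm, EuclideanSpace.norm_eq, Fin.sum_univ_three]; simp⟩

/-- The geodesic distance on the round unit sphere, `d(θ, θ') = arccos ⟨θ, θ'⟩`. -/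
def geoDist (θ θ' : S2) : ℝ := Real.arccos ⟪(θ : E3), (θ' : E3)⟫

/-- The rotation of the sphere by the angle `t` about the line through the two poles. -/
def axialRotation (t : ℝ) (θ : S2) : S2 :=
  ⟨!₂[Real.cos t * (θ : E3) 0 - Real.sin t * (θ : E3) 1,
      Real.sin t * (θ : E3) 0 + Real.cos t * (θ : E3) 1, (θ : E3) 2], by
    rw [mem_sphere_zero_iff_norm, EuclideanSpace.norm_eq, Fin.sum_univ_three,
      Real.sqrt_eq_one]
    simp only [Real.norm_eq_abs, sq_abs, Matrix.cons_val_zero,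
      Matrix.cons_val_one, Matrix.cons_val]
    linear_combination S2.sq_sum θ +
      ((θ : E3) 0 ^ 2 + (θ : E3) 1 ^ 2) * Real.sin_sq_add_cos_sq t⟩

/-- `v` is rotationally symmetric about the line through the poles. The poles are fixed by all
the rotations, so the value of `v` at a pole is irrelevant. -/
def IsAxiallySymmetric (v : S2 → ℝ) : Prop :=
  ∀ (t : ℝ) (θ : S2), v (axialRotation t θ) = v θ

/-- `θ` and `θ'` lie on one geodesic (great circle) through the two poles: the intersection of
the sphere with the plane spanned by `(0, 0, 1)` and `(cos t, sin t, 0)`, for some `t`. -/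
def OnCommonMeridian (θ θ' : S2) : Prop :=
  ∃ t : ℝ, Real.cos t * (θ : E3) 1 = Real.sin t * (θ : E3) 0 ∧
    Real.cos t * (θ' : E3) 1 = Real.sin t * (θ' : E3) 0

/-- `F`, as a function on the sphere minus the north pole, is non-decreasing toward the north
pole along the geodesics through the poles. -/
def IncreasesTowardNorth (F : S2 → ℝ) : Prop :=
  ∀ θ θ' : S2, θ ≠ northPole → θ' ≠ northPole → OnCommonMeridian θ θ' →
    (θ' : E3) 2 < (θ : E3) 2 → F θ' ≤ F θ

/-- The extension of a function on the sphere to `E3 \ {0}` that is constant along rays from the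
origin, `x ↦ v (x / ‖x‖)` (and the value `0` at the origin). -/
def radialExtension (v : S2 → ℝ) (x : E3) : ℝ :=
  if h : x = 0 then 0
  else v ⟨‖x‖⁻¹ • x, by
    rw [mem_sphere_zero_iff_norm, norm_smul, norm_inv, norm_norm,
      inv_mul_cancel₀ (norm_ne_zero_iff.mpr h)]⟩

/-- The Laplace-Beltrami operator of the round unit sphere: the Euclidean Laplacian, at a point
of the sphere, of the extension that is constant along rays. In polar coordinates
`Δ = ∂²/∂r² + (2/r) ∂/∂r + r⁻² Δ_{S²}`. The value at `θ` depends only on `v` near `θ`. -/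
def sphereLaplacian (v : S2 → ℝ) (θ : S2) : ℝ :=
  Laplacian.laplacian (radialExtension v) (θ : E3)

/-- The surface area measure of the round unit sphere. -/
def surfaceMeasure : Measure S2 := (volume : Measure E3).toSphere

end

/-! Stereographic projection from the south pole sends the north pole to the origin and turns `v`
into `u = v - log (1 + |p|²)`, which solves `-Δu = k e^{2u} + F` on the punctured plane with `k =
4K` and `F = 4f / (1 + |p|²)²`; the conformal factor absorbs the constant 1. Both coefficients are
radial and nonincreasing in `|p|`, so the method of moving planes applies: for `l > 0`, on the side
of the line `x = l` that contains the origin, `w = u - u ∘ reflect l` is nonnegative. Letting `l →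
0` gives a one-sided comparison in the line `x = 0`. Since the chart may be turned about the axis,
by `π` in particular, the reverse comparison holds too, and `v` is invariant under every rotation.

Convexity of `exp` gives `Δw ≤ -2cw`, where `c` is `k e^{2u}` at the reflected point. That point
stays away from the puncture, so `c ≤ C / |p|⁴`. The barrier `1 - 2C g²` with `g = (l - x) / |p|²`
(`diskLevel`) then reduces `w ≥ 0` to the compact disk `g ≥ δ`, with one `δ` for all `l ≥ l₀`
(`exists_diskLevel_bound`). At the puncture only `u ≥ ε log |p|²` is known, for every `ε > 0`;
comparison with small multiples of the logarithm shows that this suffices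
(`le_of_superharmonic_punctured`).

For large `l` the decay of `u` settles the disk (`exists_start`). Afterwards `w > 0` strictly
(`reflDiff_pos`), which lets the line pass below any positive position
(`eventually_reflDiff_nonneg`). Strictness could fail only if `f = 0` and `K` is constant. Constant
`K` with positive constant `f` is therefore admissible, and this covers the mean field equation even
for `γ = 0`: there `v = αφ/2` and `f = 1 - α/(8π) > 0`. -/

/-! ### Pointwise Laplacians from one-variable second derivatives -/

/-- `f` is differentiable near `t`, and its derivative has derivative `a` at `t`. -/
def HasSecondDerivAt (f : ℝ → ℝ) (a t : ℝ) : Prop :=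
  ∃ f' : ℝ → ℝ, (∀ᶠ s in 𝓝 t, HasDerivAt f (f' s) s) ∧ HasDerivAt f' a t

/-- The sum of the two pure second partial derivatives of `u` at `p` is `L`. -/
def HasLaplacianAt (u : ℝ × ℝ → ℝ) (L : ℝ) (p : ℝ × ℝ) : Prop :=
  ∃ a b : ℝ, HasSecondDerivAt (fun s => u (s, p.2)) a p.1 ∧
    HasSecondDerivAt (fun s => u (p.1, s)) b p.2 ∧ a + b = L

namespace HasSecondDerivAt

variable {f g : ℝ → ℝ} {a b t : ℝ}

lemma add (hf : HasSecondDerivAt f a t) (hg : HasSecondDerivAt g b t) :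
    HasSecondDerivAt (fun s => f s + g s) (a + b) t := by
  obtain ⟨f', h1, h2⟩ := hf
  obtain ⟨g', k1, k2⟩ := hg
  exact ⟨fun s => f' s + g' s, by filter_upwards [h1, k1] with s x y using x.add y, h2.add k2⟩

lemma const_mul (c : ℝ) (hf : HasSecondDerivAt f a t) :
    HasSecondDerivAt (fun s => c * f s) (c * a) t := by
  obtain ⟨f', h1, h2⟩ := hf
  exact ⟨fun s => c * f' s, by filter_upwards [h1] with s x using x.const_mul c, h2.const_mul c⟩

lemma const (c : ℝ) : HasSecondDerivAt (fun _ => c) 0 t :=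
  ⟨fun _ => 0, .of_forall fun s => hasDerivAt_const s c, hasDerivAt_const t 0⟩

lemma comp_const_sub (c : ℝ) (hf : HasSecondDerivAt f a (c - t)) :
    HasSecondDerivAt (fun s => f (c - s)) a t := by
  obtain ⟨f', h1, h2⟩ := hf
  have hc : Tendsto (fun s : ℝ => c - s) (𝓝 t) (𝓝 (c - t)) :=
    (continuous_const.sub continuous_id).tendsto t
  refine ⟨fun s => -f' (c - s), ?_, ?_⟩
  · filter_upwards [hc.eventually h1] with s hs
    exact (hs.comp s ((hasDerivAt_id s).const_sub c)).congr_deriv (by ring)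
  · exact (h2.comp t ((hasDerivAt_id t).const_sub c)).neg.congr_deriv (by ring)

lemma congr (hf : HasSecondDerivAt f a t) (h : g =ᶠ[𝓝 t] f) : HasSecondDerivAt g a t := by
  obtain ⟨f', h1, h2⟩ := hf
  refine ⟨f', ?_, h2⟩
  filter_upwards [h1, h.eventually_nhds] with s hs hs'
  exact hs.congr_of_eventuallyEq hs'

/-- If `a < 0`, then `f - (a/4)(s - t)²` still has negative second derivative `a/2` at its critical
point `t`, hence a local maximum there. Together with the local minimum of `f` this forces `(s - t)²
≤ 0` for all `s` near `t`. -/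
lemma nonneg_of_isLocalMin (hf : HasSecondDerivAt f a t) (h : IsLocalMin f t) : 0 ≤ a := by
  by_contra! ha
  obtain ⟨f', h1, h2⟩ := hf
  have h0 : HasDerivAt f (f' t) t := h1.self_of_nhds
  have hz : f' t = 0 := h.hasDerivAt_eq_zero h0
  have hG1 : ∀ᶠ s in 𝓝 t,
      HasDerivAt (fun s => f s - a / 4 * (s - t) ^ 2) (f' s - a / 2 * (s - t)) s := by
    filter_upwards [h1] with s hs
    refine (hs.sub ((((hasDerivAt_id s).sub_const t).pow 2).const_mul (a / 4))).congr_deriv ?_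
    simp; ring
  have hG2 : HasDerivAt (fun s => f' s - a / 2 * (s - t)) (a / 2) t := by
    exact (h2.sub (((hasDerivAt_id t).sub_const t).const_mul (a / 2))).congr_deriv (by ring)
  have hd : deriv (fun s => f s - a / 4 * (s - t) ^ 2) =ᶠ[𝓝 t]
      fun s => f' s - a / 2 * (s - t) := hG1.mono fun s hs => hs.deriv
  have hmax : IsLocalMax (fun s => f s - a / 4 * (s - t) ^ 2) t := by
    apply isLocalMax_of_deriv_deriv_neg
    · rw [hd.deriv_eq, hG2.deriv]; linarith
    · simp [hd.self_of_nhds, hz]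
    · exact hG1.self_of_nhds.continuousAt
  have hev : ∀ᶠ s in 𝓝 t, s = t := by
    filter_upwards [h, hmax] with s hs hs'
    simp only [sub_self] at hs'
    have : a / 4 * (s - t) ^ 2 ≥ 0 := by nlinarith
    have h3 : (s - t) ^ 2 ≤ 0 := by nlinarith
    have h4 : s - t = 0 := by nlinarith [sq_nonneg (s - t)]
    linarith
  have : ∃ᶠ s in 𝓝 t, s ≠ t := by
    exact frequently_iff_neBot.2 (inferInstanceAs (𝓝[≠] t).NeBot)
  exact this (hev.mono fun s hs => by simpa using hs)

end HasSecondDerivAt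

namespace HasLaplacianAt

variable {u w : ℝ × ℝ → ℝ} {L M : ℝ} {p : ℝ × ℝ}

lemma add (hu : HasLaplacianAt u L p) (hw : HasLaplacianAt w M p) :
    HasLaplacianAt (fun q => u q + w q) (L + M) p := by
  obtain ⟨a, b, h1, h2, rfl⟩ := hu
  obtain ⟨c, d, k1, k2, rfl⟩ := hw
  exact ⟨a + c, b + d, h1.add k1, h2.add k2, by ring⟩

lemma const_mul (c : ℝ) (hu : HasLaplacianAt u L p) :
    HasLaplacianAt (fun q => c * u q) (c * L) p := by
  obtain ⟨a, b, h1, h2, rfl⟩ := hu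
  exact ⟨c * a, c * b, h1.const_mul c, h2.const_mul c, by ring⟩

lemma const (c : ℝ) : HasLaplacianAt (fun _ => c) 0 p :=
  ⟨0, 0, .const c, .const c, by ring⟩

lemma sub (hu : HasLaplacianAt u L p) (hw : HasLaplacianAt w M p) :
    HasLaplacianAt (fun q => u q - w q) (L - M) p := by
  simpa [sub_eq_add_neg] using hu.add (hw.const_mul (-1))

/-- The Laplacian commutes with the reflection `x ↦ c - x` of the first coordinate. -/
lemma comp_reflection (c : ℝ) (hu : HasLaplacianAt u L (c - p.1, p.2)) :
    HasLaplacianAt (fun q => u (c - q.1, q.2)) L p := by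
  obtain ⟨a, b, h1, h2, rfl⟩ := hu
  exact ⟨a, b, h1.comp_const_sub c, h2, rfl⟩

lemma nonneg_of_isLocalMin (hu : HasLaplacianAt u L p) (h : IsLocalMin u p) : 0 ≤ L := by
  obtain ⟨a, b, h1, h2, rfl⟩ := hu
  have k1 : IsLocalMin (fun s => u (s, p.2)) p.1 := by
    have : Tendsto (fun s : ℝ => (s, p.2)) (𝓝 p.1) (𝓝 p) :=
      (continuous_id.prodMk continuous_const).tendsto' _ _ rfl
    exact this.eventually h
  have k2 : IsLocalMin (fun s => u (p.1, s)) p.2 := by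
    have : Tendsto (fun s : ℝ => (p.1, s)) (𝓝 p.2) (𝓝 p) :=
      (continuous_const.prodMk continuous_id).tendsto' _ _ rfl
    exact this.eventually h
  exact add_nonneg (h1.nonneg_of_isLocalMin k1) (h2.nonneg_of_isLocalMin k2)

end HasLaplacianAt

/-! ### Laplacians of the explicit comparison functions -/

lemma hasSecondDerivAt_sq_add (a c t : ℝ) :
    HasSecondDerivAt (fun s => (s - a) ^ 2 + c) 2 t := by
  refine ⟨fun s => 2 * (s - a), .of_forall fun s => ?_, ?_⟩
  · exact ((((hasDerivAt_id s).sub_const a).pow 2).add_const c).congr_deriv (by simp)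
  · simpa using ((hasDerivAt_id t).sub_const a).const_mul 2

lemma hasSecondDerivAt_log {c t : ℝ} (h : 0 < t ^ 2 + c) :
    HasSecondDerivAt (fun s => Real.log (s ^ 2 + c)) (2 * (c - t ^ 2) / (t ^ 2 + c) ^ 2) t := by
  have hd : ∀ s : ℝ, HasDerivAt (fun s : ℝ => s ^ 2 + c) (2 * s) s := fun s => by
    simpa using (hasDerivAt_pow 2 s).add_const c
  have hc : ∀ᶠ s in 𝓝 t, 0 < s ^ 2 + c :=
    ((continuous_pow 2).add continuous_const).continuousAt.eventually (lt_mem_nhds h)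
  refine ⟨fun s => 2 * s / (s ^ 2 + c), ?_, ?_⟩
  · filter_upwards [hc] with s hs using (hd s).log hs.ne'
  · refine (((hasDerivAt_id t).const_mul 2).div (hd t) h.ne').congr_deriv ?_
    simp; ring

lemma hasSecondDerivAt_inv {a c t : ℝ} (h : 0 < (t - a) ^ 2 + c) :
    HasSecondDerivAt (fun s => ((s - a) ^ 2 + c)⁻¹)
      ((6 * (t - a) ^ 2 - 2 * c) / ((t - a) ^ 2 + c) ^ 3) t := by
  have hd : ∀ s : ℝ, HasDerivAt (fun s : ℝ => (s - a) ^ 2 + c) (2 * (s - a)) s := fun s => by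
    exact ((((hasDerivAt_id s).sub_const a).pow 2).add_const c).congr_deriv (by simp)
  have hc : ∀ᶠ s in 𝓝 t, 0 < (s - a) ^ 2 + c :=
    (((continuous_id.sub continuous_const).pow 2).add
      continuous_const).continuousAt.eventually (lt_mem_nhds h)
  refine ⟨fun s => -(2 * (s - a)) / ((s - a) ^ 2 + c) ^ 2, ?_, ?_⟩
  · filter_upwards [hc] with s hs using (hd s).inv hs.ne'
  · refine ((((hasDerivAt_id t).sub_const a).const_mul 2).neg.div ((hd t).pow 2)
      (pow_pos h 2).ne').congr_deriv ?_
    simp only [id, Pi.pow_apply, Pi.neg_apply, Nat.cast_ofNat, Nat.add_one_sub_one, pow_one,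
      mul_one]
    have := h.ne'
    field_simp
    ring

/-- The square of the Euclidean distance in the coordinate plane. -/
def sqDist (p q : ℝ × ℝ) : ℝ := (p.1 - q.1) ^ 2 + (p.2 - q.2) ^ 2

lemma sqDist_nonneg (p q : ℝ × ℝ) : 0 ≤ sqDist p q := by unfold sqDist; positivity

lemma sqDist_comm (p q : ℝ × ℝ) : sqDist p q = sqDist q p := by unfold sqDist; ring

lemma sqDist_eq_zero {p q : ℝ × ℝ} : sqDist p q = 0 ↔ p = q := by
  constructor
  · intro h
    unfold sqDist at h
    ext <;> nlinarith [sq_nonneg (p.1 - q.1), sq_nonneg (p.2 - q.2)]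
  · rintro rfl; simp [sqDist]

lemma sqDist_pos {p q : ℝ × ℝ} (h : p ≠ q) : 0 < sqDist p q :=
  (sqDist_nonneg p q).lt_of_ne fun h' => h (sqDist_eq_zero.1 h'.symm)

lemma sqDist_zero (p : ℝ × ℝ) : sqDist p 0 = p.1 ^ 2 + p.2 ^ 2 := by simp [sqDist]

@[fun_prop]
lemma continuous_sqDist (q : ℝ × ℝ) : Continuous fun p => sqDist p q := by
  unfold sqDist; fun_prop

lemma isCompact_of_sqDist_le {S : Set (ℝ × ℝ)} (hS : IsClosed S) {q : ℝ × ℝ} {R : ℝ}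
    (h : ∀ p ∈ S, sqDist p q ≤ R) : IsCompact S := by
  refine Metric.isCompact_of_isClosed_isBounded hS
    ((Metric.isBounded_closedBall (x := q) (r := R + 1)).subset fun p hp => ?_)
  have h1 := h p hp
  unfold sqDist at h1
  rw [Metric.mem_closedBall, Prod.dist_eq, max_le_iff, Real.dist_eq, Real.dist_eq]
  constructor <;> apply abs_le_of_sq_le_sq' _ _ |> abs_le.2 <;>
    nlinarith [sq_nonneg (p.1 - q.1), sq_nonneg (p.2 - q.2)]

lemma hasLaplacianAt_sqDist (q p : ℝ × ℝ) : HasLaplacianAt (fun z => sqDist z q) 4 p := by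
  refine ⟨2, 2, hasSecondDerivAt_sq_add q.1 ((p.2 - q.2) ^ 2) p.1, ?_, by norm_num⟩
  exact (hasSecondDerivAt_sq_add q.2 ((p.1 - q.1) ^ 2) p.2).congr
    (.of_forall fun s => add_comm _ _)

lemma hasLaplacianAt_log {c : ℝ} {p : ℝ × ℝ} (h : 0 < sqDist p 0 + c) :
    HasLaplacianAt (fun z => Real.log (sqDist z 0 + c)) (4 * c / (sqDist p 0 + c) ^ 2) p := by
  simp only [sqDist_zero] at *
  have h1 := hasSecondDerivAt_log (t := p.1) (c := p.2 ^ 2 + c) (by linarith)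
  have h2 := hasSecondDerivAt_log (t := p.2) (c := p.1 ^ 2 + c) (by linarith)
  refine ⟨_, _, h1.congr (.of_forall fun s => ?_), h2.congr (.of_forall fun s => ?_), ?_⟩
  · exact congrArg Real.log (by ring)
  · exact congrArg Real.log (by ring)
  · rw [show p.2 ^ 2 + (p.1 ^ 2 + c) = p.1 ^ 2 + (p.2 ^ 2 + c) by ring,
      show p.1 ^ 2 + p.2 ^ 2 + c = p.1 ^ 2 + (p.2 ^ 2 + c) by ring]
    ring

lemma hasLaplacianAt_inv {p q : ℝ × ℝ} (h : p ≠ q) :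
    HasLaplacianAt (fun z => (sqDist z q)⁻¹) (4 / sqDist p q ^ 2) p := by
  have h0 := sqDist_pos h
  unfold sqDist at h0
  have h1 := hasSecondDerivAt_inv (t := p.1) (a := q.1) (c := (p.2 - q.2) ^ 2) h0
  have h2 := hasSecondDerivAt_inv (t := p.2) (a := q.2) (c := (p.1 - q.1) ^ 2) (by linarith)
  refine ⟨_, _, h1, h2.congr (.of_forall fun s => ?_), ?_⟩
  · simp only [sqDist]
    rw [add_comm]
  · rw [sqDist, add_comm ((p.2 - q.2) ^ 2)]
    have := h0.ne'
    field_simp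
    ring

lemma hasSecondDerivAt_div_sq_left {l c t : ℝ} (h : 0 < t ^ 2 + c) :
    HasSecondDerivAt (fun s => ((l - s) / (s ^ 2 + c)) ^ 2)
      (2 * (-1 / (t ^ 2 + c) - 2 * t * (l - t) / (t ^ 2 + c) ^ 2) ^ 2 +
        2 * ((l - t) / (t ^ 2 + c)) * (4 * t / (t ^ 2 + c) ^ 2 - 2 * (l - t) / (t ^ 2 + c) ^ 2 +
          8 * t ^ 2 * (l - t) / (t ^ 2 + c) ^ 3)) t := by
  have hd : ∀ s : ℝ, HasDerivAt (fun s : ℝ => s ^ 2 + c) (2 * s) s := fun s => by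
    simpa using (hasDerivAt_pow 2 s).add_const c
  have hl : ∀ s : ℝ, HasDerivAt (fun s : ℝ => l - s) (-1) s := fun s => by
    simpa using (hasDerivAt_id s).const_sub l
  have hc : ∀ᶠ s in 𝓝 t, 0 < s ^ 2 + c :=
    ((continuous_pow 2).add continuous_const).continuousAt.eventually (lt_mem_nhds h)
  refine ⟨fun s => 2 * ((l - s) / (s ^ 2 + c)) *
    ((-1 * (s ^ 2 + c) - (l - s) * (2 * s)) / (s ^ 2 + c) ^ 2), ?_, ?_⟩
  · filter_upwards [hc] with s hs
    exact (((hl s).div (hd s) hs.ne').pow 2).congr_deriv (by simp)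
  · have h1 := ((hl t).div (hd t) h.ne').const_mul 2
    have h2 := (((hd t).const_mul (-1)).sub ((hl t).mul ((hasDerivAt_id t).const_mul 2))).div
      ((hd t).pow 2) (pow_pos h 2).ne'
    refine (h1.mul h2).congr_deriv ?_
    simp
    have := h.ne'
    field_simp
    ring

lemma hasSecondDerivAt_div_sq_right {l c t : ℝ} (h : 0 < t ^ 2 + c) :
    HasSecondDerivAt (fun s => (l / (s ^ 2 + c)) ^ 2)
      (l ^ 2 * (-4 / (t ^ 2 + c) ^ 3 + 24 * t ^ 2 / (t ^ 2 + c) ^ 4)) t := by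
  have hd : ∀ s : ℝ, HasDerivAt (fun s : ℝ => s ^ 2 + c) (2 * s) s := fun s => by
    simpa using (hasDerivAt_pow 2 s).add_const c
  have hc : ∀ᶠ s in 𝓝 t, 0 < s ^ 2 + c :=
    ((continuous_pow 2).add continuous_const).continuousAt.eventually (lt_mem_nhds h)
  refine ⟨fun s => l ^ 2 * (-4 * s / (s ^ 2 + c) ^ 3), ?_, ?_⟩
  · filter_upwards [hc] with s hs
    refine (((hasDerivAt_const s l).div (hd s) hs.ne').pow 2).congr_deriv ?_
    simp
    have := hs.ne'
    field_simp
    ring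
  · refine ((((hasDerivAt_id t).const_mul (-4)).div ((hd t).pow 3)
      (pow_pos h 3).ne').const_mul (l ^ 2)).congr_deriv ?_
    simp only [id, Pi.pow_apply, Nat.cast_ofNat, Nat.add_one_sub_one, mul_one]
    have := h.ne'
    field_simp
    ring

/-- The function whose level sets are the circles tangent at infinity to the line `x = l`. -/
noncomputable def diskLevel (l : ℝ) (p : ℝ × ℝ) : ℝ := (l - p.1) / sqDist p 0

/-- In the inverted variable `y = p / |p|²` the level function is `g = l|y|² - y₁`, so `|∇g|² = (1 +
4lg) / |p|⁴` and `Δg = 4l / |p|⁴`; then `Δ(g²) = 2|∇g|² + 2gΔg`. What matters later is the lower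
bound `2 / |p|⁴` where `g ≥ 0`. -/
lemma hasLaplacianAt_diskLevel_sq (l : ℝ) {p : ℝ × ℝ} (h : p ≠ 0) :
    HasLaplacianAt (fun z => diskLevel l z ^ 2)
      ((2 + 16 * l * diskLevel l p) / sqDist p 0 ^ 2) p := by
  have h0 := sqDist_pos h
  have h1 := hasSecondDerivAt_div_sq_left (l := l) (t := p.1) (c := p.2 ^ 2)
    (by simpa [sqDist_zero] using h0)
  have h2 := hasSecondDerivAt_div_sq_right (l := l - p.1) (t := p.2) (c := p.1 ^ 2)
    (by simpa [sqDist_zero, add_comm] using h0)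
  refine ⟨_, _, h1.congr (.of_forall fun s => ?_), h2.congr (.of_forall fun s => ?_), ?_⟩
  · simp only [diskLevel, sqDist_zero]
  · simp only [diskLevel, sqDist_zero]
    rw [add_comm]
  · simp only [diskLevel, sqDist_zero] at *
    rw [add_comm (p.2 ^ 2)]
    have := h0.ne'
    field_simp
    ring

/-! ### Minimum principles -/

/-- Minimum principle: a function on a compact set that has negative Laplacian at every interior
point at which it is negative, and is nonnegative on the boundary, is nonnegative. -/
lemma nonneg_of_hasLaplacianAt_neg {S : Set (ℝ × ℝ)} (hS : IsCompact S) {Φ : ℝ × ℝ → ℝ}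
    (hc : ContinuousOn Φ S)
    (h : ∀ p ∈ S, Φ p < 0 → S ∈ 𝓝 p ∧ ∃ L < 0, HasLaplacianAt Φ L p) :
    ∀ p ∈ S, 0 ≤ Φ p := by
  intro p hp
  obtain ⟨m, hm, hmin⟩ := hS.exists_isMinOn ⟨p, hp⟩ hc
  by_contra! hneg
  obtain ⟨hn, L, hL, hLap⟩ := h m hm ((hmin hp).trans_lt hneg)
  exact absurd (hLap.nonneg_of_isLocalMin (hmin.isLocalMin hn)) (not_le.2 hL)

lemma exists_sqDist_lt_of_mem_nhds {S : Set (ℝ × ℝ)} {q : ℝ × ℝ} (h : S ∈ 𝓝 q) :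
    ∃ r > 0, ∀ p, sqDist p q < r → p ∈ S := by
  obtain ⟨ε, hε, hs⟩ := Metric.mem_nhds_iff.1 h
  refine ⟨ε ^ 2, by positivity, fun p hp => hs ?_⟩
  unfold sqDist at hp
  rw [Metric.mem_ball, Prod.dist_eq, max_lt_iff, Real.dist_eq, Real.dist_eq]
  constructor <;> apply abs_lt_of_sq_lt_sq _ hε.le <;>
    nlinarith [sq_nonneg (p.1 - q.1), sq_nonneg (p.2 - q.2)]

lemma exists_sqDist_lt_of_eventually {P : ℝ × ℝ → Prop} {q : ℝ × ℝ} (h : ∀ᶠ p in 𝓝[≠] q, P p) :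
    ∃ r > 0, ∀ p, p ≠ q → sqDist p q < r → P p := by
  obtain ⟨r, hr, h'⟩ := exists_sqDist_lt_of_mem_nhds (eventually_nhdsWithin_iff.1 h)
  exact ⟨r, hr, fun p hp hpr => h' p hpr hp⟩

lemma annulus_mem_nhds {q p : ℝ × ℝ} {r ρ : ℝ} (h1 : r < sqDist p q) (h2 : sqDist p q < ρ) :
    {z | r ≤ sqDist z q ∧ sqDist z q ≤ ρ} ∈ 𝓝 p := by
  have hc := (continuous_sqDist q).continuousAt (x := p)
  filter_upwards [hc.eventually (lt_mem_nhds h1), hc.eventually (gt_mem_nhds h2)] with z a b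
  exact ⟨a.le, b.le⟩

lemma isCompact_annulus (q : ℝ × ℝ) (r ρ : ℝ) :
    IsCompact {z | r ≤ sqDist z q ∧ sqDist z q ≤ ρ} :=
  isCompact_of_sqDist_le ((isClosed_le continuous_const (continuous_sqDist q)).inter
    (isClosed_le (continuous_sqDist q) continuous_const)) fun _ h => h.2

lemma tendsto_log_sqDist : Tendsto (fun p => Real.log (sqDist p 0)) (𝓝[≠] 0) atBot := by
  refine Real.tendsto_log_nhdsGT_zero.comp (tendsto_nhdsWithin_iff.2 ⟨?_, ?_⟩)
  · have := (continuous_sqDist 0).tendsto 0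
    rw [sqDist_eq_zero.2 rfl] at this
    exact this.mono_left nhdsWithin_le_nhds
  · filter_upwards [self_mem_nhdsWithin] with p hp using sqDist_pos hp

/-- Minimum principle on a punctured disk, for superharmonic functions whose negative part is
`o(|log|)` at the puncture. -/
lemma le_of_superharmonic_punctured {g : ℝ × ℝ → ℝ} {ρ η : ℝ}
    (hg : ContinuousOn g {p | p ≠ 0 ∧ sqDist p 0 ≤ ρ})
    (hL : ∀ p, p ≠ 0 → sqDist p 0 < ρ → ∃ L ≤ 0, HasLaplacianAt g L p)
    (h0 : ∀ ε > 0, ∀ᶠ p in 𝓝[≠] (0 : ℝ × ℝ), ε * Real.log (sqDist p 0) ≤ g p)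
    (hb : ∀ p, sqDist p 0 = ρ → η ≤ g p) {p : ℝ × ℝ} (hp : p ≠ 0) (hpρ : sqDist p 0 ≤ ρ) :
    η ≤ g p := by
  have hp0 := sqDist_pos hp
  -- The logarithm is harmonic and vanishes relative to `log ρ` on the outer circle; the term `ε (ρ
  -- - |z|²)` makes the Laplacian strictly negative. Near the puncture half of `ε log |z|²` is spent
  -- on the lower bound for `g` and the other half absorbs the constants.
  have key : ∀ ε > 0, 0 ≤ g p - η - ε * (Real.log (sqDist p 0) - Real.log ρ)
      + ε * (ρ - sqDist p 0) := by
    intro ε hε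
    have hev : ∀ᶠ z in 𝓝[≠] (0 : ℝ × ℝ),
        0 ≤ g z - η - ε * (Real.log (sqDist z 0) - Real.log ρ) := by
      filter_upwards [h0 (ε / 2) (by positivity), tendsto_log_sqDist.eventually
        (eventually_le_atBot (-(2 / ε) * (η - ε * Real.log ρ)))] with z h1 h2
      have h3 : ε / 2 * Real.log (sqDist z 0) ≤ ε / 2 * (-(2 / ε) * (η - ε * Real.log ρ)) := by
        gcongr
      have h4 : ε / 2 * (-(2 / ε) * (η - ε * Real.log ρ)) = -(η - ε * Real.log ρ) := by
        field_simp
      nlinarith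
    obtain ⟨r, hr, hrP⟩ := exists_sqDist_lt_of_eventually hev
    set r' := min (r / 2) (sqDist p 0) with hr'
    have hr'0 : 0 < r' := lt_min (by positivity) hp0
    have hne : ∀ z : ℝ × ℝ, r' ≤ sqDist z 0 → z ≠ 0 := by
      rintro z hz rfl
      rw [sqDist_eq_zero.2 rfl] at hz
      linarith
    refine nonneg_of_hasLaplacianAt_neg (isCompact_annulus 0 r' ρ)
      (Φ := fun z => g z - η - ε * (Real.log (sqDist z 0) - Real.log ρ) + ε * (ρ - sqDist z 0))
      ?_ ?_ p ⟨min_le_right _ _, hpρ⟩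
    · have hlog : ContinuousOn (fun z => Real.log (sqDist z 0))
          {z | r' ≤ sqDist z 0 ∧ sqDist z 0 ≤ ρ} :=
        (continuous_sqDist 0).continuousOn.log fun z hz => (sqDist_pos (hne z hz.1)).ne'
      have hg' : ContinuousOn g {z | r' ≤ sqDist z 0 ∧ sqDist z 0 ≤ ρ} :=
        hg.mono fun z hz => ⟨hne z hz.1, hz.2⟩
      fun_prop
    · rintro z ⟨hz1, hz2⟩ hneg
      have hz0 := hne z hz1
      have hz2' : sqDist z 0 < ρ := by
        refine hz2.lt_of_ne fun h => ?_
        simp only [h] at hneg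
        have := hb z h
        linarith [hb z h, mul_zero ε, sub_self ρ, sub_self (Real.log ρ)]
      have hz1' : r' < sqDist z 0 := by
        refine hz1.lt_of_ne fun h => ?_
        have h1 := hrP z hz0 (by rw [← h]; exact (min_le_left _ _).trans_lt (by linarith))
        nlinarith
      obtain ⟨L, hL0, hLz⟩ := hL z hz0 hz2'
      refine ⟨annulus_mem_nhds hz1' hz2', L + (-ε * 0 + -ε * 4 + 0), by linarith, ?_⟩
      have hl := hasLaplacianAt_log (c := 0) (p := z) (by simpa using sqDist_pos hz0)
      simp only [add_zero, mul_zero, zero_div] at hl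
      have := hLz.add (((hl.const_mul (-ε)).add ((hasLaplacianAt_sqDist 0 z).const_mul (-ε))).add
        (.const (-η + ε * Real.log ρ + ε * ρ)))
      convert this using 2 with y
      ring
  by_contra! hlt
  set A := Real.log ρ - Real.log (sqDist p 0) + (ρ - sqDist p 0) with hA
  have hA0 : 0 ≤ A := by
    have := Real.log_le_log hp0 hpρ
    linarith
  have h1 := key ((η - g p) / (2 * (A + 1))) (by apply div_pos <;> linarith)
  have h2 : (η - g p) / (2 * (A + 1)) * A < η - g p := by
    rw [div_mul_eq_mul_div, div_lt_iff₀ (by linarith)]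
    nlinarith
  nlinarith

/-- Comparison on an annulus with a multiple of `1/|z - q|² - 1/ρ`, which is strictly subharmonic in
the plane and vanishes on the outer circle. The factor `w q / 2 * r'` keeps it below `w q / 2`,
hence below `w`, on the inner circle. -/
lemma pos_of_superharmonic_disk {w : ℝ × ℝ → ℝ} {q : ℝ × ℝ} {ρ : ℝ}
    (hc : ContinuousOn w {p | sqDist p q ≤ ρ}) (h0 : ∀ p, sqDist p q ≤ ρ → 0 ≤ w p)
    (hL : ∀ p, sqDist p q < ρ → ∃ L ≤ 0, HasLaplacianAt w L p) (hq : 0 < w q)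
    {p : ℝ × ℝ} (hp : sqDist p q < ρ) : 0 < w p := by
  rcases eq_or_ne p q with rfl | hpq
  · exact hq
  have hs := sqDist_pos hpq
  have hnear : ∀ᶠ z in 𝓝 q, w q / 2 < w z := by
    have hn : {p | sqDist p q ≤ ρ} ∈ 𝓝 q := by
      have := (continuous_sqDist q).continuousAt (x := q)
      have h1 : sqDist q q < ρ := by rw [sqDist_eq_zero.2 rfl]; linarith
      filter_upwards [this.eventually (gt_mem_nhds h1)] with z hz using hz.le
    exact (hc.continuousAt hn).eventually (lt_mem_nhds (by linarith))
  obtain ⟨r, hr, hrP⟩ := exists_sqDist_lt_of_mem_nhds hnear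
  set r' := min (r / 2) (sqDist p q) with hr'
  have hr'0 : 0 < r' := lt_min (by positivity) hs
  have hne : ∀ z : ℝ × ℝ, r' ≤ sqDist z q → z ≠ q := by
    rintro z hz rfl
    rw [sqDist_eq_zero.2 rfl] at hz
    linarith
  have hρ : 0 < ρ := by linarith
  have key : 0 ≤ w p - w q / 2 * r' * ((sqDist p q)⁻¹ - ρ⁻¹) := by
    refine nonneg_of_hasLaplacianAt_neg (isCompact_annulus q r' ρ)
      (Φ := fun z => w z - w q / 2 * r' * ((sqDist z q)⁻¹ - ρ⁻¹)) ?_ ?_ p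
      ⟨min_le_right _ _, hp.le⟩
    · have hinv : ContinuousOn (fun z => (sqDist z q)⁻¹)
          {z | r' ≤ sqDist z q ∧ sqDist z q ≤ ρ} :=
        (continuous_sqDist q).continuousOn.inv₀ fun z hz => (sqDist_pos (hne z hz.1)).ne'
      have hg' : ContinuousOn w {z | r' ≤ sqDist z q ∧ sqDist z q ≤ ρ} :=
        hc.mono fun z hz => hz.2
      fun_prop
    · rintro z ⟨hz1, hz2⟩ hneg
      have hz2' : sqDist z q < ρ := by
        refine hz2.lt_of_ne fun h => ?_
        simp only [h, sub_self, mul_zero, sub_zero] at hneg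
        linarith [h0 z hz2]
      have hz1' : r' < sqDist z q := by
        refine hz1.lt_of_ne fun h => ?_
        have h1 : w q / 2 < w z :=
          hrP z (by rw [← h]; exact (min_le_left _ _).trans_lt (by linarith))
        simp only [← h] at hneg
        have h2 : w q / 2 * r' * (r'⁻¹ - ρ⁻¹) = w q / 2 - w q / 2 * r' * ρ⁻¹ := by
          field_simp
        have h3 : 0 < w q / 2 * r' * ρ⁻¹ := by positivity
        linarith
      obtain ⟨L, hL0, hLz⟩ := hL z hz2'
      have hz := hne z hz1
      have hzs := sqDist_pos hz
      refine ⟨annulus_mem_nhds hz1' hz2', L - w q / 2 * r' * (4 / sqDist z q ^ 2 - 0), ?_,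
        hLz.sub (((hasLaplacianAt_inv hz).sub (.const _)).const_mul _)⟩
      have : 0 < w q / 2 * r' * (4 / sqDist z q ^ 2) := by positivity
      linarith
  have h1 : 0 < (sqDist p q)⁻¹ - ρ⁻¹ := sub_pos.2 ((inv_lt_inv₀ hρ hs).2 hp)
  have : 0 < w q / 2 * r' * ((sqDist p q)⁻¹ - ρ⁻¹) := by positivity
  linarith

/-- Strong minimum principle for nonnegative superharmonic functions. -/
lemma pos_of_superharmonic {w : ℝ × ℝ → ℝ} {U : Set (ℝ × ℝ)} (hU : IsOpen U)
    (hpre : IsPreconnected U) (hc : ContinuousOn w U) (h0 : ∀ p ∈ U, 0 ≤ w p)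
    (hL : ∀ p ∈ U, ∃ L ≤ 0, HasLaplacianAt w L p) {q : ℝ × ℝ} (hqU : q ∈ U) (hq : 0 < w q) :
    ∀ p ∈ U, 0 < w p := by
  set G := U ∩ w ⁻¹' Ioi 0 with hG
  have hGo : IsOpen G := hc.isOpen_inter_preimage hU isOpen_Ioi
  suffices U ⊆ G from fun p hp => (this hp).2
  refine hpre.subset_of_closure_inter_subset hGo ⟨q, hqU, hqU, hq⟩ ?_
  rintro p ⟨hpc, hpU⟩
  obtain ⟨r, hr, hrU⟩ := exists_sqDist_lt_of_mem_nhds (hU.mem_nhds hpU)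
  -- `sqDist` is a squared distance: the disk of squared radius `r/8` about `z` contains `p`, and
  -- its points have squared distance at most `2 (r/8 + r/16) < r` from `p`.
  have hev : ∀ᶠ z in 𝓝 p, sqDist z p < r / 16 := by
    have := (continuous_sqDist p).continuousAt (x := p)
    exact this.eventually (gt_mem_nhds (by simp only [sqDist_eq_zero.2]; positivity))
  obtain ⟨z, hzG, hzr⟩ := (mem_closure_iff_frequently.1 hpc).and_eventually hev |>.exists
  have hsub : ∀ y, sqDist y z ≤ r / 8 → y ∈ U := by
    intro y hy
    apply hrU
    unfold sqDist at *
    nlinarith [sq_nonneg (y.1 - z.1 - (z.1 - p.1)), sq_nonneg (y.2 - z.2 - (z.2 - p.2))]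
  refine ⟨hpU, pos_of_superharmonic_disk (q := z) (ρ := r / 8) (hc.mono hsub)
    (fun y hy => h0 y (hsub y hy)) (fun y hy => hL y (hsub y hy.le)) hzG.2 ?_⟩
  rw [sqDist_comm]
  linarith

/-! ### Reflections and the planar equation -/

/-- The half-plane `x < l` with the origin removed. -/
def puncturedHalfPlane (l : ℝ) : Set (ℝ × ℝ) := {p | p.1 < l ∧ p ≠ 0}

lemma isOpen_puncturedHalfPlane (l : ℝ) : IsOpen (puncturedHalfPlane l) :=
  (isOpen_lt continuous_fst continuous_const).inter isOpen_ne

lemma isPreconnected_puncturedHalfPlane {l : ℝ} (hl : 0 < l) :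
    IsPreconnected (puncturedHalfPlane l) := by
  have hA : Convex ℝ {p : ℝ × ℝ | p.1 < l ∧ 0 < p.2} :=
    (convex_halfSpace_lt (LinearMap.fst ℝ ℝ ℝ).isLinear l).inter
      (convex_halfSpace_gt (LinearMap.snd ℝ ℝ ℝ).isLinear 0)
  have hB : Convex ℝ {p : ℝ × ℝ | p.1 < l ∧ p.2 < 0} :=
    (convex_halfSpace_lt (LinearMap.fst ℝ ℝ ℝ).isLinear l).inter
      (convex_halfSpace_lt (LinearMap.snd ℝ ℝ ℝ).isLinear 0)
  have hC : Convex ℝ {p : ℝ × ℝ | p.1 < 0} :=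
    convex_halfSpace_lt (LinearMap.fst ℝ ℝ ℝ).isLinear 0
  have hD : Convex ℝ {p : ℝ × ℝ | p.1 < l ∧ 0 < p.1} :=
    (convex_halfSpace_lt (LinearMap.fst ℝ ℝ ℝ).isLinear l).inter
      (convex_halfSpace_gt (LinearMap.fst ℝ ℝ ℝ).isLinear 0)
  have h1 := IsPreconnected.union (s := {p : ℝ × ℝ | p.1 < l ∧ 0 < p.2})
    (t := {p : ℝ × ℝ | p.1 < 0}) (-1, 1) ⟨by simp only; linarith, by simp⟩ (by simp)
    hA.isPreconnected hC.isPreconnected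
  have h2 := h1.union' (t := {p : ℝ × ℝ | p.1 < l ∧ p.2 < 0})
    ⟨(-1, -1), Or.inr (by simp), by simp only; linarith, by simp⟩ hB.isPreconnected
  have h3 := h2.union' (t := {p : ℝ × ℝ | p.1 < l ∧ 0 < p.1})
    ⟨(l / 2, 1), Or.inl (Or.inl ⟨by simp only; linarith, by simp⟩), by simp only; linarith,
      by simp only; linarith⟩ hD.isPreconnected
  convert h3 using 1
  ext ⟨x, y⟩
  simp only [puncturedHalfPlane, mem_ofPred_eq, mem_union, ne_eq, Prod.mk_eq_zero]
  constructor
  · rintro ⟨h, h'⟩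
    rcases lt_trichotomy y 0 with hy | hy | hy
    · tauto
    · rcases lt_trichotomy x 0 with hx | hx | hx <;> tauto
    · tauto
  · rintro (((⟨h, h'⟩ | h) | ⟨h, h'⟩) | ⟨h, h'⟩)
    · exact ⟨h, fun h'' => h'.ne' h''.2⟩
    · exact ⟨h.trans hl, fun h'' => h.ne h''.1⟩
    · exact ⟨h, fun h'' => h'.ne h''.2⟩
    · exact ⟨h, fun h'' => h'.ne' h''.1⟩

/-- The reflection of the coordinate plane in the line `x = l`. -/
def reflect (l : ℝ) (p : ℝ × ℝ) : ℝ × ℝ := (2 * l - p.1, p.2)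

lemma sqDist_reflect (l : ℝ) (p : ℝ × ℝ) :
    sqDist (reflect l p) 0 = sqDist p 0 + 4 * l * (l - p.1) := by
  simp only [sqDist_zero, reflect]; ring

lemma ne_zero_of_fst_pos {p : ℝ × ℝ} (h : 0 < p.1) : p ≠ 0 := by
  rintro rfl; simp at h

lemma le_reflect_fst {l : ℝ} {p : ℝ × ℝ} (h : p.1 ≤ l) : l ≤ (reflect l p).1 := by
  simp only [reflect]; linarith

lemma reflect_ne_zero {l : ℝ} (hl : 0 < l) {p : ℝ × ℝ} (h : p.1 ≤ l) : reflect l p ≠ 0 :=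
  ne_zero_of_fst_pos (hl.trans_le (le_reflect_fst h))

@[fun_prop]
lemma continuous_reflect (l : ℝ) : Continuous (reflect l) := by
  unfold reflect; fun_prop

/-- The difference between a function and its reflection in the line `x = l`. -/
def reflDiff (u : ℝ × ℝ → ℝ) (l : ℝ) (p : ℝ × ℝ) : ℝ := u p - u (reflect l p)

lemma reflDiff_of_fst_eq (u : ℝ × ℝ → ℝ) {l : ℝ} {p : ℝ × ℝ} (h : p.1 = l) :
    reflDiff u l p = 0 := by
  have : reflect l p = p := by
    ext
    · simp only [reflect]; linarith
    · rfl
  rw [reflDiff, this, sub_self]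

/-- Solutions of `-Δu = k e^{2u} + F` on the punctured plane, with `k` and `F` nonincreasing under
reflection away from the origin, which decay at infinity like the logarithm of the conformal
factor of the sphere and are not too negative at the origin. -/
structure IsPlanarSolution (u k F : ℝ × ℝ → ℝ) : Prop where
  continuousOn : ContinuousOn u {0}ᶜ
  hasLaplacianAt : ∀ p, p ≠ 0 → HasLaplacianAt u (-(k p * Real.exp (2 * u p) + F p)) p
  k_nonneg : ∀ p, p ≠ 0 → 0 ≤ k p
  F_nonneg : ∀ p, p ≠ 0 → 0 ≤ F p
  k_reflect_le : ∀ l > 0, ∀ p ∈ puncturedHalfPlane l, k (reflect l p) ≤ k p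
  F_reflect_le : ∀ l > 0, ∀ p ∈ puncturedHalfPlane l, F (reflect l p) ≤ F p
  bound : ∀ l > 0, ∃ C, ∀ p : ℝ × ℝ, l ≤ p.1 → k p * Real.exp (2 * u p) * sqDist p 0 ^ 2 ≤ C
  lower : ∀ ε > 0, ∀ᶠ p in 𝓝[≠] (0 : ℝ × ℝ), ε * Real.log (sqDist p 0) ≤ u p
  limit : ∃ c, Tendsto (fun p => u p + Real.log (1 + sqDist p 0)) (cocompact (ℝ × ℝ)) (𝓝 c)
  nondegenerate : ∀ l > 0, ∃ p ∈ puncturedHalfPlane l,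
    ¬ (k (reflect l p) = k p ∧ F (reflect l p) = F p)

namespace IsPlanarSolution

variable {u k F : ℝ × ℝ → ℝ}

lemma continuousAt (h : IsPlanarSolution u k F) {p : ℝ × ℝ} (hp : p ≠ 0) : ContinuousAt u p :=
  h.continuousOn.continuousAt (isOpen_compl_singleton.mem_nhds hp)

lemma continuousAt_reflect (h : IsPlanarSolution u k F) {l : ℝ} (hl : 0 < l) {p : ℝ × ℝ}
    (hp : p.1 ≤ l) : ContinuousAt (fun z => u (reflect l z)) p :=
  ContinuousAt.comp (f := reflect l) (h.continuousAt (reflect_ne_zero hl hp))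
    (continuous_reflect l).continuousAt

lemma continuousAt_reflDiff (h : IsPlanarSolution u k F) {l : ℝ} (hl : 0 < l) {p : ℝ × ℝ}
    (hp : p.1 ≤ l) (hp0 : p ≠ 0) : ContinuousAt (reflDiff u l) p :=
  (h.continuousAt hp0).sub (h.continuousAt_reflect hl hp)

lemma hasLaplacianAt_reflDiff (h : IsPlanarSolution u k F) {l : ℝ} (hl : 0 < l) {p : ℝ × ℝ}
    (hp : p ∈ puncturedHalfPlane l) :
    HasLaplacianAt (reflDiff u l) (-(k p * Real.exp (2 * u p) + F p) -
      -(k (reflect l p) * Real.exp (2 * u (reflect l p)) + F (reflect l p))) p :=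
  (h.hasLaplacianAt p hp.2).sub
    ((h.hasLaplacianAt _ (reflect_ne_zero hl hp.1.le)).comp_reflection (2 * l))

/-- The coefficients only help, as they are smaller at the reflected point, and the tangent line
inequality `e^{2a} ≥ e^{2b} (1 + 2(a - b))` linearises the rest. Expanding at the reflected point
keeps the singularity of `u` out of the coefficient. -/
lemma exists_laplacian_le (h : IsPlanarSolution u k F) {l : ℝ} (hl : 0 < l) {p : ℝ × ℝ}
    (hp : p ∈ puncturedHalfPlane l) :
    ∃ L ≤ -(2 * (k (reflect l p) * Real.exp (2 * u (reflect l p)))) * reflDiff u l p,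
      HasLaplacianAt (reflDiff u l) L p := by
  refine ⟨_, ?_, h.hasLaplacianAt_reflDiff hl hp⟩
  have h1 := h.k_reflect_le l hl p hp
  have h2 := h.F_reflect_le l hl p hp
  have h3 := h.k_nonneg _ (reflect_ne_zero hl hp.1.le)
  have h4 := Real.add_one_le_exp (2 * u p - 2 * u (reflect l p))
  have h5 : Real.exp (2 * u p) = Real.exp (2 * u (reflect l p)) *
      Real.exp (2 * u p - 2 * u (reflect l p)) := by rw [← Real.exp_add]; congr 1; ring
  have h6 : 0 < Real.exp (2 * u (reflect l p)) := Real.exp_pos _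
  have h7 : 0 < Real.exp (2 * u p) := Real.exp_pos _
  have h8 : Real.exp (2 * u (reflect l p)) * (2 * u p - 2 * u (reflect l p) + 1) ≤
      Real.exp (2 * u p) := by rw [h5]; gcongr
  have h9 : k (reflect l p) * Real.exp (2 * u p) ≤ k p * Real.exp (2 * u p) := by gcongr
  have h10 := mul_le_mul_of_nonneg_left h8 h3
  unfold reflDiff
  linarith

lemma exists_laplacian_nonpos (h : IsPlanarSolution u k F) {l : ℝ} (hl : 0 < l) {p : ℝ × ℝ}
    (hp : p ∈ puncturedHalfPlane l) (hw : 0 ≤ reflDiff u l p) :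
    ∃ L ≤ 0, HasLaplacianAt (reflDiff u l) L p := by
  obtain ⟨L, hL, hLap⟩ := h.exists_laplacian_le hl hp
  refine ⟨L, hL.trans ?_, hLap⟩
  have h3 := h.k_nonneg _ (reflect_ne_zero hl hp.1.le)
  have : 0 ≤ 2 * (k (reflect l p) * Real.exp (2 * u (reflect l p))) * reflDiff u l p := by
    positivity
  linarith

/-! ### Behaviour at infinity and at the puncture; starting the planes -/

lemma exists_radius (h : IsPlanarSolution u k F) : ∃ c, ∀ ε > 0, ∃ R > 0, ∀ p, R ≤ sqDist p 0 →
    |u p + Real.log (1 + sqDist p 0) - c| < ε := by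
  obtain ⟨c, hc⟩ := h.limit
  refine ⟨c, fun ε hε => ?_⟩
  obtain ⟨t, ht, hts⟩ := mem_cocompact.1 (hc.eventually (Metric.ball_mem_nhds c hε))
  obtain ⟨R, hR⟩ := ht.exists_bound_of_continuousOn (continuous_sqDist 0).continuousOn
  refine ⟨max R 0 + 1, by positivity, fun p hp => ?_⟩
  have hpt : p ∈ tᶜ := by
    intro hp'
    have := (le_abs_self _).trans (hR p hp')
    linarith [le_max_left R 0]
  simpa [Real.dist_eq] using hts hpt

/-- The reflected point is the farther one, so the logarithms in the expansion at infinity have the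
favourable sign and only the two error terms remain. -/
lemma exists_reflDiff_ge (h : IsPlanarSolution u k F) {l : ℝ} (hl : 0 < l) {ε : ℝ} (hε : 0 < ε) :
    ∃ R, ∀ p : ℝ × ℝ, p.1 ≤ l → R ≤ sqDist p 0 → -ε ≤ reflDiff u l p := by
  obtain ⟨c, hc⟩ := h.exists_radius
  obtain ⟨R, -, hR⟩ := hc (ε / 2) (by positivity)
  refine ⟨R, fun p hp hpR => ?_⟩
  have hs : sqDist p 0 ≤ sqDist (reflect l p) 0 := by
    rw [sqDist_reflect]; nlinarith
  have h1 := abs_lt.1 (hR p hpR)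
  have h2 := abs_lt.1 (hR _ (hpR.trans hs))
  have h3 : Real.log (1 + sqDist p 0) ≤ Real.log (1 + sqDist (reflect l p) 0) :=
    Real.log_le_log (by linarith [sqDist_nonneg p 0]) (by linarith)
  unfold reflDiff
  linarith [h1.1, h2.2]

lemma log_one_add_sqDist_nonneg (p : ℝ × ℝ) : 0 ≤ Real.log (1 + sqDist p 0) :=
  Real.log_nonneg (by linarith [sqDist_nonneg p 0])

/-- Outside a large disk this is the expansion at infinity. Inside, `u` is superharmonic, so the
punctured minimum principle bounds it below by its minimum on the circle. -/
lemma exists_lower_bound (h : IsPlanarSolution u k F) :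
    ∃ B, ∀ p, p ≠ 0 → B ≤ u p + Real.log (1 + sqDist p 0) := by
  obtain ⟨c, hc⟩ := h.exists_radius
  obtain ⟨R, hR0, hR⟩ := hc 1 one_pos
  have hcirc : ∀ p, sqDist p 0 = R → p ≠ 0 := by
    rintro p hp rfl
    rw [sqDist_eq_zero.2 rfl] at hp
    linarith
  have hcp : IsCompact {p | sqDist p 0 = R} :=
    isCompact_of_sqDist_le (isClosed_eq (continuous_sqDist 0) continuous_const) fun p hp => hp.le
  obtain ⟨η, hη⟩ := hcp.bddBelow_image (h.continuousOn.mono hcirc)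
  refine ⟨min η (c - 1), fun p hp => ?_⟩
  rcases le_total R (sqDist p 0) with h1 | h1
  · have := abs_lt.1 (hR p h1)
    linarith [min_le_right η (c - 1)]
  · have : η ≤ u p := by
      refine le_of_superharmonic_punctured (ρ := R) (h.continuousOn.mono fun z hz => hz.1)
        (fun z hz _ => ⟨_, ?_, h.hasLaplacianAt z hz⟩) h.lower
        (fun z hz => hη (mem_image_of_mem u hz)) hp h1
      have := h.k_nonneg z hz
      have := h.F_nonneg z hz
      have := Real.exp_pos (2 * u z)
      have : 0 ≤ k z * Real.exp (2 * u z) := by positivity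
      linarith
    linarith [min_le_left η (c - 1), log_one_add_sqDist_nonneg p]

/-- Restricted to `x ≥ l` because `u` may be unbounded above at the origin; reflected points lie in
this region. -/
lemma exists_upper_bound (h : IsPlanarSolution u k F) {l : ℝ} (hl : 0 < l) :
    ∃ B, ∀ p : ℝ × ℝ, l ≤ p.1 → u p + Real.log (1 + sqDist p 0) ≤ B := by
  obtain ⟨c, hc⟩ := h.exists_radius
  obtain ⟨R, hR0, hR⟩ := hc 1 one_pos
  have hcp : IsCompact {p : ℝ × ℝ | l ≤ p.1 ∧ sqDist p 0 ≤ R} :=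
    isCompact_of_sqDist_le ((isClosed_le continuous_const continuous_fst).inter
      (isClosed_le (continuous_sqDist 0) continuous_const)) fun p hp => hp.2
  have hcont : ContinuousOn (fun p => u p + Real.log (1 + sqDist p 0))
      {p : ℝ × ℝ | l ≤ p.1 ∧ sqDist p 0 ≤ R} := by
    have h1 : ContinuousOn u {p : ℝ × ℝ | l ≤ p.1 ∧ sqDist p 0 ≤ R} :=
      h.continuousOn.mono fun p hp => ne_zero_of_fst_pos (hl.trans_le hp.1)
    have h2 : Continuous fun p => Real.log (1 + sqDist p 0) := by
      refine Continuous.log (by fun_prop) fun p => ?_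
      linarith [sqDist_nonneg p 0]
    exact h1.add h2.continuousOn
  obtain ⟨η, hη⟩ := hcp.bddAbove_image hcont
  refine ⟨max η (c + 1), fun p hp => ?_⟩
  rcases le_total R (sqDist p 0) with h1 | h1
  · have := abs_lt.1 (hR p h1)
    linarith [le_max_right η (c + 1)]
  · exact (hη (mem_image_of_mem _ ⟨hp, h1⟩)).trans (le_max_left _ _)

/-- Maximum principle near the line `x = l` and near infinity. -/
lemma reflDiff_nonneg_of_diskLevel (h : IsPlanarSolution u k F) {l C δ : ℝ} (hl : 0 < l)
    (hC0 : 0 < C)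
    (hC : ∀ p : ℝ × ℝ, l ≤ p.1 → k p * Real.exp (2 * u p) * sqDist p 0 ^ 2 ≤ C)
    (hδC : 2 * C * δ ^ 2 ≤ 1 / 2)
    (hK : ∀ p ∈ puncturedHalfPlane l, δ * sqDist p 0 ≤ l - p.1 → 0 ≤ reflDiff u l p) :
    ∀ p ∈ puncturedHalfPlane l, 0 ≤ reflDiff u l p := by
  intro p₀ hp₀
  by_contra! hneg
  set T : Set (ℝ × ℝ) := {p | p.1 ≤ l ∧ l - p.1 ≤ δ * sqDist p 0} with hT
  have hTc : IsClosed T := (isClosed_le continuous_fst continuous_const).inter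
    (isClosed_le (continuous_const.sub continuous_fst)
      (continuous_const.mul (continuous_sqDist 0)))
  have hT0 : ∀ p ∈ T, p ≠ 0 := by
    rintro p hp rfl
    have := hp.2
    rw [sqDist_eq_zero.2 rfl] at this
    simp at this
    linarith
  -- The barrier: `1/2 ≤ b ≤ 1` on `T`, and `Δb ≤ -4C / |p|⁴` dominates the coefficient `2c ≤ 2C /
  -- |p|⁴`.
  set b : ℝ × ℝ → ℝ := fun p => 1 - 2 * C * diskLevel l p ^ 2 with hb
  have hg : ∀ p ∈ T, 0 ≤ diskLevel l p ∧ diskLevel l p ≤ δ := fun p hp =>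
    ⟨div_nonneg (sub_nonneg.2 hp.1) (sqDist_nonneg p 0),
      (div_le_iff₀ (sqDist_pos (hT0 p hp))).2 hp.2⟩
  have hb1 : ∀ p, b p ≤ 1 := fun p => by
    have : 0 ≤ 2 * C * diskLevel l p ^ 2 := by positivity
    simp only [hb]; linarith
  have hb2 : ∀ p ∈ T, 1 / 2 ≤ b p := fun p hp => by
    have h1 : 2 * C * diskLevel l p ^ 2 ≤ 2 * C * δ ^ 2 := by
      have := (hg p hp).1
      have := (hg p hp).2
      gcongr
    simp only [hb]; linarith
  have hp₀T : p₀ ∈ T := by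
    refine ⟨hp₀.1.le, ?_⟩
    by_contra! hlt
    exact absurd (hK p₀ hp₀ hlt.le) (not_le.2 hneg)
  set a := -reflDiff u l p₀ with ha
  -- With `a / 4`, points beyond `R` satisfy `w + μ b ≥ -a/4 + a/2 > 0` once `μ ≥ a`, so the minimum
  -- of `w / b` over the bounded part controls all of `T`.
  obtain ⟨R, hR⟩ := h.exists_reflDiff_ge hl (ε := a / 4) (by linarith)
  have hSc : IsCompact (T ∩ {p | sqDist p 0 ≤ R}) :=
    isCompact_of_sqDist_le (hTc.inter (isClosed_le (continuous_sqDist 0) continuous_const))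
      fun p hp => hp.2
  have hwc : ContinuousOn (reflDiff u l) T := fun p hp =>
    (h.continuousAt_reflDiff hl hp.1 (hT0 p hp)).continuousWithinAt
  have hbc : ContinuousOn b T := by
    have : ContinuousOn (diskLevel l) T :=
      (continuous_const.sub continuous_fst).continuousOn.div (continuous_sqDist 0).continuousOn
        fun p hp => (sqDist_pos (hT0 p hp)).ne'
    fun_prop
  have hp₀S : p₀ ∈ T ∩ {p | sqDist p 0 ≤ R} := by
    refine ⟨hp₀T, ?_⟩
    by_contra hlt
    have := hR p₀ hp₀.1.le (not_le.1 hlt).le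
    linarith
  obtain ⟨m, hm, hmin⟩ := hSc.exists_isMinOn ⟨p₀, hp₀S⟩
    ((hwc.div hbc fun p hp => by linarith [hb2 p hp]).mono inter_subset_left)
  have hmT := hm.1
  have hbm := hb2 m hmT
  set μ := -(reflDiff u l m / b m) with hμ
  have hμa : a ≤ μ := by
    have h1 : reflDiff u l m / b m ≤ reflDiff u l p₀ / b p₀ := hmin hp₀S
    have h2 : reflDiff u l p₀ / b p₀ ≤ reflDiff u l p₀ := by
      rw [div_le_iff₀ (by linarith [hb2 p₀ hp₀T])]
      nlinarith [hb1 p₀]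
    linarith
  have hμ0 : 0 < μ := by linarith
  have hwm : reflDiff u l m = -μ * b m := by
    rw [hμ]; field_simp
  have hΦ : ∀ p ∈ T, 0 ≤ reflDiff u l p + μ * b p := by
    intro p hp
    have hbp := hb2 p hp
    rcases le_total (sqDist p 0) R with h1 | h1
    · have h2 : reflDiff u l m / b m ≤ reflDiff u l p / b p := hmin ⟨hp, h1⟩
      rw [le_div_iff₀ (by linarith)] at h2
      have : μ * b p = -(reflDiff u l m / b m * b p) := by rw [hμ]; ring
      linarith
    · have := hR p hp.1 h1
      nlinarith
  have hwm_neg : reflDiff u l m < 0 := by rw [hwm]; nlinarith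
  have hm1 : m.1 < l := hmT.1.lt_of_ne fun h' => by
    rw [reflDiff_of_fst_eq u h'] at hwm_neg; exact lt_irrefl _ hwm_neg
  have hmP : m ∈ puncturedHalfPlane l := ⟨hm1, hT0 m hmT⟩
  have hm2 : l - m.1 < δ * sqDist m 0 := by
    by_contra! h'
    exact absurd (hK m hmP h') (not_le.2 hwm_neg)
  have hTn : T ∈ 𝓝 m := by
    filter_upwards [(isOpen_lt continuous_fst continuous_const).mem_nhds hm1,
      (isOpen_lt (continuous_const.sub continuous_fst)
        (continuous_const.mul (continuous_sqDist 0))).mem_nhds hm2] with z h1 h2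
    exact ⟨le_of_lt h1, le_of_lt h2⟩
  have hloc : IsLocalMin (fun p => reflDiff u l p + μ * b p) m := by
    filter_upwards [hTn] with z hz
    rw [hwm]
    linarith [hΦ z hz]
  -- At the interior minimum `m` of `w + μ b`, where it vanishes, the Laplacian is at most `μ (2C -
  -- 4C) / |m|⁴ < 0`, a contradiction.
  obtain ⟨L, hL, hLap⟩ := h.exists_laplacian_le hl hmP
  have hLb := (HasLaplacianAt.const (p := m) 1).sub
    ((hasLaplacianAt_diskLevel_sq l (hT0 m hmT)).const_mul (2 * C))
  have h0 := (hLap.add (hLb.const_mul μ)).nonneg_of_isLocalMin hloc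
  have hs := sqDist_pos (hT0 m hmT)
  have hss : sqDist m 0 ≤ sqDist (reflect l m) 0 := by
    rw [sqDist_reflect]; nlinarith
  have hk := h.k_nonneg _ (reflect_ne_zero hl hm1.le)
  set c := k (reflect l m) * Real.exp (2 * u (reflect l m)) with hc
  have hc0 : 0 ≤ c := by positivity
  have hcC : c ≤ C / sqDist m 0 ^ 2 := by
    rw [le_div_iff₀ (by positivity)]
    refine le_trans ?_ (hC _ (le_reflect_fst hm1.le))
    gcongr
  have h1 : 2 / sqDist m 0 ^ 2 ≤ (2 + 16 * l * diskLevel l m) / sqDist m 0 ^ 2 := by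
    have := (hg m hmT).1
    gcongr
    have : 0 ≤ 16 * l * diskLevel l m := by positivity
    linarith
  have h2 : 2 * C * (2 / sqDist m 0 ^ 2) ≤
      2 * C * ((2 + 16 * l * diskLevel l m) / sqDist m 0 ^ 2) := by gcongr
  have h3 : 0 < C / sqDist m 0 ^ 2 := by positivity
  have h4 : 2 * C * (2 / sqDist m 0 ^ 2) = 4 * (C / sqDist m 0 ^ 2) := by ring
  have h5 : c * b m ≤ c := mul_le_of_le_one_right hc0 (hb1 m)
  rw [hwm] at hL
  have h6 : L ≤ μ * (2 * (c * b m)) := by linarith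
  have h7 : μ * (2 * (c * b m) + (0 - 2 * C * ((2 + 16 * l * diskLevel l m) / sqDist m 0 ^ 2)))
      < 0 := mul_neg_of_pos_of_neg hμ0 (by linarith)
  linarith

/-- The bound `C` on `x ≥ l₀` serves every `l ≥ l₀`, so `δ` does not depend on `l`. This uniformity
is needed both to start the planes and to move them. -/
lemma exists_diskLevel_bound (h : IsPlanarSolution u k F) {l₀ : ℝ} (hl₀ : 0 < l₀) :
    ∃ δ > 0, ∀ l ≥ l₀,
      (∀ p ∈ puncturedHalfPlane l, δ * sqDist p 0 ≤ l - p.1 → 0 ≤ reflDiff u l p) →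
      ∀ p ∈ puncturedHalfPlane l, 0 ≤ reflDiff u l p := by
  obtain ⟨C, hC⟩ := h.bound l₀ hl₀
  have hC1 : 1 ≤ max C 1 := le_max_right _ _
  refine ⟨1 / (2 * max C 1), by positivity, fun l hl hK => ?_⟩
  refine h.reflDiff_nonneg_of_diskLevel (hl₀.trans_le hl) (C := max C 1) (by linarith)
    (fun p hp => (hC p (hl.trans hp)).trans (le_max_left _ _)) ?_ hK
  have : 2 * max C 1 * (1 / (2 * max C 1)) ^ 2 = 1 / (2 * max C 1) := by field_simp
  rw [this]
  exact one_div_le_one_div_of_le (by norm_num) (by linarith)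

lemma exists_start (h : IsPlanarSolution u k F) :
    ∃ l₁ > 0, ∀ l ≥ l₁, ∀ p ∈ puncturedHalfPlane l, 0 ≤ reflDiff u l p := by
  obtain ⟨δ, hδ, hδP⟩ := h.exists_diskLevel_bound one_pos
  obtain ⟨B, hB⟩ := h.exists_lower_bound
  obtain ⟨B', hB'⟩ := h.exists_upper_bound one_pos
  -- In the disk `δ|p|² ≤ l - x` one has `|p|² ≤ 2l/δ + 1/δ²`, so `1 + |p|² ≤ A l` for `l ≥ 1`,
  -- whereas the reflected point has squared norm at least `l²`. The threshold on `l` lets `l²` beat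
  -- `e^{B' - B} A l`.
  set A := 1 + 2 / δ + 1 / δ ^ 2 with hA
  refine ⟨max 1 (Real.exp (B' - B) * A), by positivity, fun l hl => ?_⟩
  have hl1 : 1 ≤ l := (le_max_left _ _).trans hl
  have hl2 : Real.exp (B' - B) * A ≤ l := (le_max_right _ _).trans hl
  refine hδP l hl1 fun p hp hpK => ?_
  have h1 := hB p hp.2
  have h2 := hB' (reflect l p) (hl1.trans (le_reflect_fst hp.1.le))
  have hs : 1 + sqDist p 0 ≤ A * l := by
    have e1 : p.1 ^ 2 ≤ sqDist p 0 := by rw [sqDist_zero]; nlinarith [sq_nonneg p.2]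
    have e2 : δ ^ 2 * sqDist p 0 ≤ 2 * δ * l + 1 := by
      have := mul_le_mul_of_nonneg_left hpK hδ.le
      nlinarith [sq_nonneg (δ * p.1 + 1), mul_le_mul_of_nonneg_left e1 (sq_nonneg δ)]
    have e3 : sqDist p 0 ≤ 2 / δ * l + 1 / δ ^ 2 := by
      have : 2 / δ * l + 1 / δ ^ 2 = (2 * δ * l + 1) / δ ^ 2 := by field_simp
      rw [this, le_div_iff₀ (by positivity)]
      linarith
    have e4 : 0 < 1 / δ ^ 2 := by positivity
    rw [hA]
    nlinarith
  have hs' : l ^ 2 ≤ sqDist (reflect l p) 0 := by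
    have := le_reflect_fst hp.1.le
    rw [sqDist_zero]
    nlinarith [sq_nonneg (reflect l p).2]
  have h3 : Real.exp (B' - B) * (1 + sqDist p 0) ≤ 1 + sqDist (reflect l p) 0 := by
    have e1 : Real.exp (B' - B) * (1 + sqDist p 0) ≤ Real.exp (B' - B) * (A * l) := by gcongr
    have e2 : Real.exp (B' - B) * A * l ≤ l * l := by gcongr
    nlinarith
  have hpos : 0 < 1 + sqDist p 0 := by linarith [sqDist_nonneg p 0]
  have h4 := Real.log_le_log (by positivity) h3
  rw [Real.log_mul (Real.exp_ne_zero _) hpos.ne', Real.log_exp] at h4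
  unfold reflDiff
  linarith

/-! ### Strict positivity and moving the planes down to the origin -/

lemma reflDiff_nonneg_of_forall_gt (h : IsPlanarSolution u k F) {l : ℝ} (hl : 0 < l)
    (hgt : ∀ l' > l, ∀ p ∈ puncturedHalfPlane l', 0 ≤ reflDiff u l' p) :
    ∀ p ∈ puncturedHalfPlane l, 0 ≤ reflDiff u l p := by
  intro p hp
  have hc : ContinuousAt (fun l' => reflDiff u l' p) l := by
    have : ContinuousAt (fun l' => u (reflect l' p)) l :=
      ContinuousAt.comp (f := fun l' => reflect l' p)
        (h.continuousAt (reflect_ne_zero hl hp.1.le)) (by unfold reflect; fun_prop)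
    exact continuousAt_const.sub this
  refine ge_of_tendsto (hc.tendsto.mono_left (nhdsWithin_le_nhds (s := Ioi l))) ?_
  filter_upwards [self_mem_nhdsWithin] with l' hl'
  exact hgt l' hl' p ⟨hp.1.trans hl', hp.2⟩

/-- A nonnegative `w` is superharmonic, so by the strong minimum principle it is positive everywhere
or identically zero. In the second case both `w` and `-w` have local minima, so the two right-hand
sides agree and `k`, `F` are symmetric in the line, contrary to `nondegenerate`. -/
lemma reflDiff_pos (h : IsPlanarSolution u k F) {l : ℝ} (hl : 0 < l)
    (h0 : ∀ p ∈ puncturedHalfPlane l, 0 ≤ reflDiff u l p) :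
    ∀ p ∈ puncturedHalfPlane l, 0 < reflDiff u l p := by
  have hex : ∃ q ∈ puncturedHalfPlane l, 0 < reflDiff u l q := by
    by_contra! hno
    have hz : ∀ q ∈ puncturedHalfPlane l, reflDiff u l q = 0 := fun q hq =>
      le_antisymm (hno q hq) (h0 q hq)
    obtain ⟨p, hp, hne⟩ := h.nondegenerate l hl
    have hL := h.hasLaplacianAt_reflDiff hl hp
    have hloc : IsLocalMin (fun z => -1 * reflDiff u l z) p := by
      filter_upwards [(isOpen_puncturedHalfPlane l).mem_nhds hp] with z hz'
      rw [hz p hp, hz z hz']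
    have h1 := (hL.const_mul (-1)).nonneg_of_isLocalMin hloc
    have hloc2 : IsLocalMin (reflDiff u l) p := by
      filter_upwards [(isOpen_puncturedHalfPlane l).mem_nhds hp] with z hz'
      rw [hz p hp, hz z hz']
    have h2 := hL.nonneg_of_isLocalMin hloc2
    have hu : u (reflect l p) = u p := by
      have := hz p hp
      unfold reflDiff at this
      linarith
    rw [hu] at h1 h2
    have h3 := h.k_reflect_le l hl p hp
    have h4 := h.F_reflect_le l hl p hp
    have h5 := Real.exp_pos (2 * u p)
    have h6 : 0 ≤ (k p - k (reflect l p)) * Real.exp (2 * u p) :=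
      mul_nonneg (by linarith) h5.le
    have h7 : (k p - k (reflect l p)) * Real.exp (2 * u p) = 0 := by nlinarith
    have h8 : k p - k (reflect l p) = 0 := (mul_eq_zero.1 h7).resolve_right h5.ne'
    refine hne ⟨by linarith, ?_⟩
    have h9 : k p = k (reflect l p) := by linarith
    rw [h9] at h2
    linarith
  obtain ⟨q, hq, hqp⟩ := hex
  exact pos_of_superharmonic (isOpen_puncturedHalfPlane l) (isPreconnected_puncturedHalfPlane hl)
    (fun p hp => (h.continuousAt_reflDiff hl hp.1.le hp.2).continuousWithinAt) h0
    (fun p hp => h.exists_laplacian_nonpos hl hp (h0 p hp)) hq hqp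

/-- A compact part of the half-plane on which a positive `reflDiff` is bounded away from zero. -/
lemma exists_reflDiff_ge_of_compact (h : IsPlanarSolution u k F) {l : ℝ} (hl : 0 < l)
    (h0 : ∀ p ∈ puncturedHalfPlane l, 0 < reflDiff u l p) {S : Set (ℝ × ℝ)} (hS : IsCompact S)
    (hSl : ∀ p ∈ S, p.1 < l) : ∃ η > 0, ∀ p ∈ S, p ≠ 0 → η ≤ reflDiff u l p := by
  have hmin : ∀ K : Set (ℝ × ℝ), IsCompact K → K ⊆ puncturedHalfPlane l →
      ∃ η > 0, ∀ p ∈ K, η ≤ reflDiff u l p := by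
    intro K hK hKl
    rcases K.eq_empty_or_nonempty with rfl | hne
    · exact ⟨1, one_pos, by simp⟩
    · obtain ⟨m, hm, hmin⟩ := hK.exists_isMinOn hne (f := reflDiff u l) fun p hp =>
        (h.continuousAt_reflDiff hl (hKl hp).1.le (hKl hp).2).continuousWithinAt
      exact ⟨_, h0 m (hKl hm), fun p hp => hmin hp⟩
  set ρ := (l / 2) ^ 2 with hρ
  have hρ0 : 0 < ρ := by positivity
  have hsmall : ∀ p, sqDist p 0 ≤ ρ → p.1 < l := by
    intro p hp
    rw [sqDist_zero, hρ] at hp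
    nlinarith [sq_nonneg p.2]
  have hne : ∀ p, ρ ≤ sqDist p 0 → p ≠ 0 := by
    rintro p hp rfl
    rw [sqDist_eq_zero.2 rfl] at hp
    linarith
  obtain ⟨η₁, hη₁, hP₁⟩ := hmin {p | ρ ≤ sqDist p 0 ∧ sqDist p 0 ≤ ρ} (isCompact_annulus 0 ρ ρ)
    fun p hp => ⟨hsmall p hp.2, hne p hp.1⟩
  obtain ⟨η₂, hη₂, hP₂⟩ := hmin (S ∩ {p | ρ ≤ sqDist p 0})
    (hS.inter_right (isClosed_le continuous_const (continuous_sqDist 0)))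
    fun p hp => ⟨hSl p hp.1, hne p hp.2⟩
  refine ⟨min η₁ η₂, lt_min hη₁ hη₂, fun p hp hp0 => ?_⟩
  rcases le_total ρ (sqDist p 0) with h1 | h1
  · exact (min_le_right _ _).trans (hP₂ p ⟨hp, h1⟩)
  refine (min_le_left _ _).trans ?_
  obtain ⟨B, hB⟩ := h.exists_upper_bound hl
  refine le_of_superharmonic_punctured (ρ := ρ) (fun z hz =>
      (h.continuousAt_reflDiff hl (hsmall z hz.2).le hz.1).continuousWithinAt)
    (fun z hz hzρ => h.exists_laplacian_nonpos hl ⟨hsmall z hzρ.le, hz⟩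
      (h0 z ⟨hsmall z hzρ.le, hz⟩).le) (fun ε hε => ?_) (fun z hz => hP₁ z ⟨hz.ge, hz.le⟩) hp0 h1
  have hnear : ∀ᶠ z in 𝓝[≠] (0 : ℝ × ℝ), z.1 < l :=
    nhdsWithin_le_nhds ((isOpen_lt continuous_fst continuous_const).mem_nhds hl)
  filter_upwards [h.lower (ε / 2) (by positivity), hnear,
    tendsto_log_sqDist.eventually (eventually_le_atBot (-(2 / ε) * B))] with z a1 a2 a3
  have b1 := hB _ (le_reflect_fst a2.le)
  have b2 := log_one_add_sqDist_nonneg (reflect l z)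
  have b3 : ε / 2 * Real.log (sqDist z 0) ≤ ε / 2 * (-(2 / ε) * B) := by gcongr
  have b4 : ε / 2 * (-(2 / ε) * B) = -B := by field_simp
  unfold reflDiff
  linarith

/-- On the compact disk for `l`, `w` is at least some `η > 0`, a margin that survives a small
displacement of the line; the complement of the disk is handled by `exists_diskLevel_bound` at level
`l/2`. -/
lemma eventually_reflDiff_nonneg (h : IsPlanarSolution u k F) {l : ℝ} (hl : 0 < l)
    (h0 : ∀ p ∈ puncturedHalfPlane l, 0 ≤ reflDiff u l p) :
    ∀ᶠ l' in 𝓝[≤] l, ∀ p ∈ puncturedHalfPlane l', 0 ≤ reflDiff u l' p := by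
  obtain ⟨δ, hδ, hδP⟩ := h.exists_diskLevel_bound (half_pos hl)
  set S : Set (ℝ × ℝ) := {p | δ * sqDist p 0 ≤ l - p.1} with hS
  have hSc : IsCompact S := by
    refine isCompact_of_sqDist_le (q := 0) (R := (2 * δ * l + 1) / δ ^ 2)
      (isClosed_le (continuous_const.mul (continuous_sqDist 0))
        (continuous_const.sub continuous_fst)) fun p hp => ?_
    have e1 : p.1 ^ 2 ≤ sqDist p 0 := by rw [sqDist_zero]; nlinarith [sq_nonneg p.2]
    rw [le_div_iff₀ (by positivity)]
    have := mul_le_mul_of_nonneg_left (show δ * sqDist p 0 ≤ l - p.1 from hp) hδ.le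
    nlinarith [sq_nonneg (δ * p.1 + 1), mul_le_mul_of_nonneg_left e1 (sq_nonneg δ)]
  have hSl : ∀ p ∈ S, p.1 < l := by
    intro p hp
    have h1 : δ * sqDist p 0 ≤ l - p.1 := hp
    by_contra! h2
    have h3 : p ≠ 0 := ne_zero_of_fst_pos (hl.trans_le h2)
    have := mul_pos hδ (sqDist_pos h3)
    linarith
  obtain ⟨η, hη, hηS⟩ := h.exists_reflDiff_ge_of_compact hl (h.reflDiff_pos hl h0) hSc hSl
  -- Only the reflected term depends on the position of the line, and it is evaluated away from the
  -- origin; the singular term `u p` never moves.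
  have hev : ∀ᶠ l' in 𝓝 l, ∀ p ∈ S, u (reflect l' p) < u (reflect l p) + η := by
    refine hSc.eventually_forall_of_forall_eventually fun p hp => ?_
    have hne : reflect l p ≠ 0 := reflect_ne_zero hl (hSl p hp).le
    have c1 : ContinuousAt (fun z : ℝ × ℝ × ℝ => u (reflect z.1 z.2)) (l, p) :=
      ContinuousAt.comp (f := fun z : ℝ × ℝ × ℝ => reflect z.1 z.2) (h.continuousAt hne)
        (by unfold reflect; fun_prop)
    have c2 : ContinuousAt (fun z : ℝ × ℝ × ℝ => u (reflect l z.2) + η) (l, p) :=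
      (ContinuousAt.comp (f := fun z : ℝ × ℝ × ℝ => reflect l z.2) (h.continuousAt hne)
        (by unfold reflect; fun_prop)).add continuousAt_const
    exact c1.eventually_lt c2 (by simp only; linarith)
  filter_upwards [nhdsWithin_le_nhds hev, self_mem_nhdsWithin,
    nhdsWithin_le_nhds (lt_mem_nhds (half_lt_self hl))] with l' h1 h2 h3
  have h2' : l' ≤ l := h2
  refine hδP l' h3.le fun p hp hpK => ?_
  have hpS : p ∈ S := le_trans hpK (by linarith)
  have h4 := h1 p hpS
  have h5 := hηS p hpS hp.2
  unfold reflDiff at *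
  linarith

/-- The method of moving planes. -/
theorem reflDiff_nonneg (h : IsPlanarSolution u k F) {l : ℝ} (hl : 0 < l) :
    ∀ p ∈ puncturedHalfPlane l, 0 ≤ reflDiff u l p := by
  set A : Set ℝ := {a | 0 < a ∧ ∀ l ≥ a, ∀ p ∈ puncturedHalfPlane l, 0 ≤ reflDiff u l p} with hA
  have hAne : A.Nonempty := h.exists_start
  have hAb : BddBelow A := ⟨0, fun a ha => ha.1.le⟩
  have hgt : ∀ l' > sInf A, ∀ p ∈ puncturedHalfPlane l', 0 ≤ reflDiff u l' p := by
    intro l' hl'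
    obtain ⟨a, ha, hal⟩ := exists_lt_of_csInf_lt hAne hl'
    exact ha.2 l' hal.le
  have h0 : 0 ≤ sInf A := le_csInf hAne fun a ha => ha.1.le
  rcases h0.eq_or_lt with h0 | h0
  · exact hgt l (by rw [← h0]; exact hl)
  have hev := h.eventually_reflDiff_nonneg h0 (h.reflDiff_nonneg_of_forall_gt h0 hgt)
  obtain ⟨b, hb, hbP⟩ := (mem_nhdsLE_iff_exists_Ioc_subset' h0).1
    (inter_mem hev (nhdsWithin_le_nhds (lt_mem_nhds h0)))
  have hb' : b < sInf A := hb
  have hmid : (b + sInf A) / 2 ∈ A := by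
    refine ⟨(hbP ⟨by linarith, by linarith⟩).2, fun l' hl' => ?_⟩
    rcases le_or_gt l' (sInf A) with h1 | h1
    · exact (hbP ⟨by linarith, h1⟩).1
    · exact hgt l' h1
  linarith [csInf_le hAb hmid]

/-- Limiting case: the reflection in the line `x = 0`. -/
theorem reflect_zero_le (h : IsPlanarSolution u k F) {p : ℝ × ℝ} (hp : p.1 < 0) :
    u (reflect 0 p) ≤ u p := by
  have hne : reflect 0 p ≠ 0 := ne_zero_of_fst_pos (by simp only [reflect]; linarith)
  have hp0 : p ≠ 0 := by rintro rfl; simp at hp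
  have hc : ContinuousAt (fun l => u (reflect l p)) 0 :=
    ContinuousAt.comp (f := fun l' => reflect l' p) (h.continuousAt hne)
      (by unfold reflect; fun_prop)
  refine le_of_tendsto (hc.tendsto.mono_left (nhdsWithin_le_nhds (s := Ioi 0))) ?_
  filter_upwards [self_mem_nhdsWithin] with l hl
  have := h.reflDiff_nonneg hl p ⟨hp.trans hl, hp0⟩
  unfold reflDiff at this
  linarith

end IsPlanarSolution

/-! ### Second-order calculus of the radial extension -/

lemma HasSecondDerivAt.unique {f : ℝ → ℝ} {a b t : ℝ} (hf : HasSecondDerivAt f a t)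
    (hg : HasSecondDerivAt f b t) : a = b := by
  obtain ⟨f', h1, h2⟩ := hf
  obtain ⟨g', k1, k2⟩ := hg
  have : f' =ᶠ[𝓝 t] g' := by filter_upwards [h1, k1] with s x y using x.unique y
  exact h2.unique (k2.congr_of_eventuallyEq this)

lemma ContDiffAt.eventually_hasDerivAt_comp {V : E3 → ℝ} {γ γ' : ℝ → E3} {t : ℝ}
    (hV : ContDiffAt ℝ 2 V (γ t)) (h1 : ∀ᶠ s in 𝓝 t, HasDerivAt γ (γ' s) s) :
    ∀ᶠ s in 𝓝 t, HasDerivAt (fun s => V (γ s)) (fderiv ℝ V (γ s) (γ' s)) s := by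
  have hc : ContinuousAt γ t := h1.self_of_nhds.continuousAt
  filter_upwards [h1, hc.eventually (hV.eventually (by simp))] with s hs hVs
  exact (hVs.differentiableAt (by norm_num)).hasFDerivAt.comp_hasDerivAt s hs

/-- Second-order chain rule along a curve. -/
lemma ContDiffAt.hasSecondDerivAt_comp {V : E3 → ℝ} {γ γ' : ℝ → E3} {γ'' : E3} {t : ℝ}
    (hV : ContDiffAt ℝ 2 V (γ t)) (h1 : ∀ᶠ s in 𝓝 t, HasDerivAt γ (γ' s) s)
    (h2 : HasDerivAt γ' γ'' t) :
    HasSecondDerivAt (fun s => V (γ s))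
      (fderiv ℝ (fderiv ℝ V) (γ t) (γ' t) (γ' t) + fderiv ℝ V (γ t) γ'') t := by
  refine ⟨_, hV.eventually_hasDerivAt_comp h1, ?_⟩
  have hd : DifferentiableAt ℝ (fderiv ℝ V) (γ t) :=
    (hV.fderiv_right (m := 1) (by norm_num)).differentiableAt (by norm_num)
  exact (hd.hasFDerivAt.comp_hasDerivAt t h1.self_of_nhds).clm_apply h2

lemma radialExtension_smul (v : S2 → ℝ) {c : ℝ} (hc : 0 < c) (x : E3) :
    radialExtension v (c • x) = radialExtension v x := by
  unfold radialExtension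
  rcases eq_or_ne x 0 with rfl | hx
  · simp
  · rw [dif_neg hx, dif_neg (smul_ne_zero hc.ne' hx)]
    congr 2
    rw [norm_smul, Real.norm_of_nonneg hc.le, smul_smul]
    congr 1
    have := norm_ne_zero_iff.2 hx
    field_simp

lemma radialExtension_coe (v : S2 → ℝ) (θ : S2) : radialExtension v θ = v θ := by
  have h1 : ‖(θ : E3)‖ = 1 := by simp
  unfold radialExtension
  rw [dif_neg (norm_ne_zero_iff.1 (by rw [h1]; exact one_ne_zero))]
  congr 1
  ext1
  simp [h1]

/-- The extension is constant along rays: differentiate `s ↦ V (s • x)` once and twice at `s = 1`.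
-/
lemma fderiv_radialExtension_self {v : S2 → ℝ} {x : E3}
    (hV : ContDiffAt ℝ 2 (radialExtension v) x) :
    fderiv ℝ (radialExtension v) x x = 0 ∧
      fderiv ℝ (fderiv ℝ (radialExtension v)) x x x = 0 := by
  have h1 : ∀ᶠ s in 𝓝 (1 : ℝ), HasDerivAt (fun s : ℝ => s • x) x s :=
    .of_forall fun s => by simpa using (hasDerivAt_id s).smul_const x
  have hV' : ContDiffAt ℝ 2 (radialExtension v) ((1 : ℝ) • x) := by simpa using hV
  have hconst : (fun s : ℝ => radialExtension v (s • x)) =ᶠ[𝓝 1]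
      fun _ => radialExtension v x := by
    filter_upwards [lt_mem_nhds (zero_lt_one' ℝ)] with s hs using radialExtension_smul v hs x
  constructor
  · have h2 := (hV'.eventually_hasDerivAt_comp h1).self_of_nhds
    simp only [one_smul] at h2
    exact h2.unique ((hasDerivAt_const 1 _).congr_of_eventuallyEq hconst)
  · have h2 := hV'.hasSecondDerivAt_comp h1 (hasDerivAt_const 1 x)
    simp only [one_smul, map_zero, add_zero] at h2
    exact h2.unique ((HasSecondDerivAt.const _).congr hconst)

lemma contDiffAt_radialExtension {v : S2 → ℝ} {θ : S2}
    (hv : ContMDiffAt (𝓡 2) 𝓘(ℝ, ℝ) 2 v θ) : ContDiffAt ℝ 2 (radialExtension v) (θ : E3) := by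
  let U : TopologicalSpace.Opens E3 := ⟨{0}ᶜ, isOpen_compl_singleton⟩
  have hU : ∀ x : U, (x : E3) ≠ 0 := fun x => x.2
  have hθ : (θ : E3) ∈ U := by
    change (θ : E3) ≠ 0
    rw [← norm_ne_zero_iff]
    simp
  have hmem : ∀ x : U, ‖(x : E3)‖⁻¹ • (x : E3) ∈ Metric.sphere (0 : E3) 1 := fun x => by
    rw [mem_sphere_zero_iff_norm, norm_smul, norm_inv, norm_norm,
      inv_mul_cancel₀ (norm_ne_zero_iff.mpr (hU x))]
  have hsm : ContMDiff 𝓘(ℝ, E3) 𝓘(ℝ, E3) 2 fun x : U => ‖(x : E3)‖⁻¹ • (x : E3) := by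
    intro x
    refine (contMDiffAt_subtype_iff (f := fun x : E3 => ‖x‖⁻¹ • x)).2 ?_
    rw [contMDiffAt_iff_contDiffAt]
    exact ((contDiffAt_norm ℝ (hU x)).inv (norm_ne_zero_iff.2 (hU x))).smul contDiffAt_id
  have : Fact (Module.finrank ℝ E3 = 2 + 1) := ⟨by simp⟩
  have hcod := hsm.codRestrict_sphere (n := 2) hmem
  rw [← contMDiffAt_iff_contDiffAt]
  refine (contMDiffAt_subtype_iff (x := (⟨θ, hθ⟩ : U))).1 ?_
  have heq : (fun x : U => radialExtension v x) =
      v ∘ Set.codRestrict (fun x : U => ‖(x : E3)‖⁻¹ • (x : E3)) (Metric.sphere 0 1) hmem := by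
    funext x
    unfold radialExtension
    rw [dif_neg (hU x)]
    rfl
  rw [heq]
  have hval : Set.codRestrict (fun x : U => ‖(x : E3)‖⁻¹ • (x : E3)) (Metric.sphere 0 1) hmem
      ⟨θ, hθ⟩ = θ := by
    ext1
    simp
  exact ContMDiffAt.comp (I' := 𝓡 2) _ (by rw [hval]; exact hv) hcod.contMDiffAt

/-! ### Stereographic coordinates and conformal covariance -/

/-- The inverse of the stereographic projection from the south pole. -/
noncomputable def stereoInv (p : ℝ × ℝ) : S2 :=
  ⟨!₂[2 * p.1 / (1 + sqDist p 0), 2 * p.2 / (1 + sqDist p 0),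
      (1 - sqDist p 0) / (1 + sqDist p 0)], by
    have h : 1 + sqDist p 0 ≠ 0 := by linarith [sqDist_nonneg p 0]
    rw [mem_sphere_zero_iff_norm, EuclideanSpace.norm_eq, Fin.sum_univ_three, Real.sqrt_eq_one]
    simp only [Real.norm_eq_abs, sq_abs, Matrix.cons_val_zero, Matrix.cons_val_one,
      Matrix.cons_val]
    field_simp
    rw [sqDist_zero]
    ring⟩

/-- The inverse stereographic projection followed by a rotation about the axis. -/
noncomputable def rotStereo (t : ℝ) (p : ℝ × ℝ) : S2 := axialRotation t (stereoInv p)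

lemma rotStereo_coe (t : ℝ) (p : ℝ × ℝ) : (rotStereo t p : E3) =
    !₂[2 * (Real.cos t * p.1 - Real.sin t * p.2) / (1 + sqDist p 0),
      2 * (Real.sin t * p.1 + Real.cos t * p.2) / (1 + sqDist p 0),
      (1 - sqDist p 0) / (1 + sqDist p 0)] := by
  ext i
  fin_cases i <;> simp [rotStereo, stereoInv, axialRotation] <;> ring

/-- Velocity and acceleration of a coordinate line of the chart, in the form `-e + q W` with `W`
affine in the parameter and `q` the square root of the conformal factor. -/
lemma hasDerivAt_conformal_curve {c : ℝ} (hc : 0 ≤ c) (e E G : E3) (s : ℝ) :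
    HasDerivAt (fun s : ℝ => -e + (2 / (1 + (s ^ 2 + c))) • (s • E + G))
      ((-s * (2 / (1 + (s ^ 2 + c))) ^ 2) • (s • E + G) + (2 / (1 + (s ^ 2 + c))) • E) s ∧
    HasDerivAt (fun s : ℝ => (-s * (2 / (1 + (s ^ 2 + c))) ^ 2) • (s • E + G) +
        (2 / (1 + (s ^ 2 + c))) • E)
      ((-(2 / (1 + (s ^ 2 + c))) ^ 2 + 2 * s ^ 2 * (2 / (1 + (s ^ 2 + c))) ^ 3) • (s • E + G) +
        (2 * (-s * (2 / (1 + (s ^ 2 + c))) ^ 2)) • E) s := by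
  have hne : 1 + (s ^ 2 + c) ≠ 0 := by positivity
  have hden : HasDerivAt (fun s : ℝ => 1 + (s ^ 2 + c)) (2 * s) s := by
    simpa using ((hasDerivAt_pow 2 s).add_const c).const_add 1
  have hq : HasDerivAt (fun s : ℝ => 2 / (1 + (s ^ 2 + c))) (-s * (2 / (1 + (s ^ 2 + c))) ^ 2) s := by
    refine ((hasDerivAt_const s (2 : ℝ)).div hden hne).congr_deriv ?_
    field_simp
    ring
  have hW : HasDerivAt (fun s : ℝ => s • E + G) E s := by
    simpa using ((hasDerivAt_id s).smul_const E).add_const G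
  have hq' : HasDerivAt (fun s : ℝ => -s * (2 / (1 + (s ^ 2 + c))) ^ 2)
      (-(2 / (1 + (s ^ 2 + c))) ^ 2 + 2 * s ^ 2 * (2 / (1 + (s ^ 2 + c))) ^ 3) s := by
    refine ((hasDerivAt_id s).neg.mul (hq.pow 2)).congr_deriv ?_
    simp
    ring
  constructor
  · refine ((hq.smul hW).const_add (-e)).congr_deriv ?_
    abel
  · refine ((hq'.smul hW).add (hq.smul_const E)).congr_deriv ?_
    module

lemma laplacian_eq_of_orthonormal {V : E3 → ℝ} {x : E3} {f : Fin 3 → E3} (hf : Orthonormal ℝ f) :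
    Laplacian.laplacian V x = fderiv ℝ (fderiv ℝ V) x (f 0) (f 0) +
      fderiv ℝ (fderiv ℝ V) x (f 1) (f 1) + fderiv ℝ (fderiv ℝ V) x (f 2) (f 2) := by
  have hsp : ⊤ ≤ Submodule.span ℝ (range f) :=
    (hf.linearIndependent.span_eq_top_of_card_eq_finrank (by simp)).ge
  rw [congrFun (InnerProductSpace.laplacian_eq_iteratedFDeriv_orthonormalBasis V
    (OrthonormalBasis.mk hf hsp)) x]
  simp [Fin.sum_univ_three, iteratedFDeriv_two_apply]

/-- Conformal covariance of the Laplacian under the stereographic projection. -/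
lemma hasLaplacianAt_comp_rotStereo {v : S2 → ℝ} (t : ℝ) {p : ℝ × ℝ}
    (hv : ContMDiffAt (𝓡 2) 𝓘(ℝ, ℝ) 2 v (rotStereo t p)) :
    HasLaplacianAt (fun z => v (rotStereo t z))
      (4 / (1 + sqDist p 0) ^ 2 * sphereLaplacian v (rotStereo t p)) p := by
  obtain ⟨x, y⟩ := p
  have hV := contDiffAt_radialExtension hv
  obtain ⟨hD, hDD⟩ := fderiv_radialExtension_self hV
  set V := radialExtension v with hVdef
  set E₁ : E3 := !₂[Real.cos t, Real.sin t, 0] with hE₁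
  set E₂ : E3 := !₂[-Real.sin t, Real.cos t, 0] with hE₂
  set e : E3 := !₂[0, 0, 1] with he
  have h11 : ⟪E₁, E₁⟫ = 1 := by
    simp only [hE₁, PiLp.inner_apply, Fin.sum_univ_three]
    simp
  have h22 : ⟪E₂, E₂⟫ = 1 := by
    simp only [hE₂, PiLp.inner_apply, Fin.sum_univ_three]
    simp
  have hee : ⟪e, e⟫ = 1 := by
    simp only [he, PiLp.inner_apply, Fin.sum_univ_three]
    simp
  have h12 : ⟪E₁, E₂⟫ = 0 := by
    simp only [hE₁, hE₂, PiLp.inner_apply, Fin.sum_univ_three]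
    simp
    ring
  have h1e : ⟪E₁, e⟫ = 0 := by
    simp [hE₁, he, PiLp.inner_apply, Fin.sum_univ_three]
  have h2e : ⟪E₂, e⟫ = 0 := by
    simp [hE₂, he, PiLp.inner_apply, Fin.sum_univ_three]
  have hP : ∀ a b : ℝ, (rotStereo t (a, b) : E3) =
      -e + (2 / (1 + (a ^ 2 + b ^ 2))) • (a • E₁ + (b • E₂ + e)) := by
    intro a b
    have h1 : 1 + (a ^ 2 + b ^ 2) ≠ 0 := by positivity
    rw [rotStereo_coe]
    ext i
    fin_cases i <;> simp [sqDist_zero, hE₁, hE₂, he] <;> field_simp <;> ring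
  have hP' : ∀ a b : ℝ, (rotStereo t (a, b) : E3) =
      -e + (2 / (1 + (b ^ 2 + a ^ 2))) • (b • E₂ + (a • E₁ + e)) := by
    intro a b
    rw [hP, add_comm (a ^ 2)]
    congr 2
    abel
  have hx := hasDerivAt_conformal_curve (sq_nonneg y) e E₁ (y • E₂ + e)
  have hy := hasDerivAt_conformal_curve (sq_nonneg x) e E₂ (x • E₁ + e)
  have hVx := hV
  have hVy := hV
  rw [hP x y] at hVx
  rw [hP' x y] at hVy
  have hxx := hVx.hasSecondDerivAt_comp (.of_forall fun s => (hx s).1) (hx x).2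
  have hyy := hVy.hasSecondDerivAt_comp (.of_forall fun s => (hy s).1) (hy y).2
  rw [← hP x y] at hxx
  rw [← hP' x y, add_comm (y ^ 2) (x ^ 2)] at hyy
  refine ⟨_, _, hxx.congr (.of_forall fun s => ?_), hyy.congr (.of_forall fun s => ?_), ?_⟩
  · simp only [← hP, hVdef, radialExtension_coe]
  · simp only [← hP', hVdef, radialExtension_coe]
  set q := 2 / (1 + (x ^ 2 + y ^ 2)) with hq
  have hq0 : 0 < q := by positivity
  have hqr : q * (1 + (x ^ 2 + y ^ 2)) = 2 := by
    rw [hq]; field_simp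
  set W : E3 := x • E₁ + (y • E₂ + e) with hW
  have hW' : y • E₂ + (x • E₁ + e) = W := by rw [hW]; abel
  rw [hW']
  have hPW : (rotStereo t (x, y) : E3) = -e + q • W := hP x y
  set B := fderiv ℝ (fderiv ℝ V) (rotStereo t (x, y) : E3) with hB
  set D := fderiv ℝ V (rotStereo t (x, y) : E3) with hDdef
  -- The normalised velocities of the two coordinate lines, followed by the unit normal. The actual
  -- velocities are `q` times the first two vectors, whence the factor `q²`.
  have hon : Orthonormal ℝ ![E₁ - (x * q) • W, E₂ - (y * q) • W, -e + q • W] := by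
    have h21 : ⟪E₂, E₁⟫ = 0 := by rw [real_inner_comm]; exact h12
    have he1 : ⟪e, E₁⟫ = 0 := by rw [real_inner_comm]; exact h1e
    have he2 : ⟪e, E₂⟫ = 0 := by rw [real_inner_comm]; exact h2e
    have hWW : ⟪W, W⟫ = 1 + (x ^ 2 + y ^ 2) := by
      simp only [hW, inner_add_left, inner_add_right, real_inner_smul_left, real_inner_smul_right,
        h11, h22, hee, h12, h1e, h2e, h21, he1, he2]
      ring
    have hW1 : ⟪W, E₁⟫ = x := by
      simp only [hW, inner_add_left, real_inner_smul_left, h11, h21, he1]; ring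
    have hW2 : ⟪W, E₂⟫ = y := by
      simp only [hW, inner_add_left, real_inner_smul_left, h22, h12, he2]; ring
    have hWe : ⟪W, e⟫ = 1 := by
      simp only [hW, inner_add_left, real_inner_smul_left, h1e, h2e, hee]; ring
    have h1W : ⟪E₁, W⟫ = x := by rw [real_inner_comm]; exact hW1
    have h2W : ⟪E₂, W⟫ = y := by rw [real_inner_comm]; exact hW2
    have heW : ⟪e, W⟫ = 1 := by rw [real_inner_comm]; exact hWe
    rw [orthonormal_iff_ite]
    intro i j
    fin_cases i <;> fin_cases j <;>
      simp only [Fin.zero_eta, Fin.mk_one, Fin.reduceFinMk, Matrix.cons_val_zero,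
        Matrix.cons_val_one, Matrix.cons_val, inner_sub_left, inner_sub_right, inner_add_left,
        inner_add_right, inner_neg_left, inner_neg_right, real_inner_smul_left,
        real_inner_smul_right, h11, h22, hee, h12, h1e, h2e, h21, he1, he2, hWW, hW1, hW2, hWe,
        h1W, h2W, heW, if_true, Fin.reduceEq, if_false]
    · linear_combination x ^ 2 * q * hqr
    · linear_combination x * y * q * hqr
    · linear_combination -x * q * hqr
    · linear_combination x * y * q * hqr
    · linear_combination y ^ 2 * q * hqr
    · linear_combination -y * q * hqr
    · linear_combination -x * q * hqr
    · linear_combination -y * q * hqr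
    · linear_combination q * hqr
  have hL := laplacian_eq_of_orthonormal (V := V) (x := (rotStereo t (x, y) : E3)) hon
  simp only [Matrix.cons_val_zero, Matrix.cons_val_one, Matrix.cons_val] at hL
  rw [← hPW, ← hB, hDD, add_zero] at hL
  have e1 : (-x * q ^ 2) • W + q • E₁ = q • (E₁ - (x * q) • W) := by
    rw [smul_sub, smul_smul, show -x * q ^ 2 = -(q * (x * q)) by ring, neg_smul]; abel
  have e2 : (-y * q ^ 2) • W + q • E₂ = q • (E₂ - (y * q) • W) := by
    rw [smul_sub, smul_smul, show -y * q ^ 2 = -(q * (y * q)) by ring, neg_smul]; abel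
  -- The two accelerations add up to a radial vector, which the derivative of the extension
  -- annihilates; no first-order term survives.
  have e3 : ((-q ^ 2 + 2 * x ^ 2 * q ^ 3) • W + (2 * (-x * q ^ 2)) • E₁) +
      ((-q ^ 2 + 2 * y ^ 2 * q ^ 3) • W + (2 * (-y * q ^ 2)) • E₂) =
      (-2 * q ^ 2) • (rotStereo t (x, y) : E3) := by
    have hc : -2 * q ^ 3 = -4 * q ^ 2 + 2 * (x ^ 2 + y ^ 2) * q ^ 3 := by
      linear_combination -2 * q ^ 2 * hqr
    have h1 : (-2 * q ^ 2) • (-e + q • W) =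
        (2 * q ^ 2) • e + (-4 * q ^ 2 + 2 * (x ^ 2 + y ^ 2) * q ^ 3) • W := by
      rw [← hc]; module
    rw [hPW, h1, hW]
    module
  have e4 : 4 / (1 + sqDist (x, y) 0) ^ 2 = q ^ 2 := by
    rw [hq, sqDist_zero]; field_simp; norm_num
  rw [e1, e2, e4]
  have e5 := congrArg D e3
  rw [map_add, map_smul, hD, smul_zero] at e5
  rw [sphereLaplacian, ← hVdef, hL]
  simp only [map_smul, smul_apply, smul_eq_mul]
  linear_combination e5

/-! ### Rotations, poles and radial functions in the chart -/

lemma axialRotation_axialRotation (a b : ℝ) (θ : S2) :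
    axialRotation a (axialRotation b θ) = axialRotation (a + b) θ := by
  ext i
  fin_cases i <;> simp [axialRotation, Real.cos_add, Real.sin_add] <;> ring

lemma axialRotation_zero (θ : S2) : axialRotation 0 θ = θ := by
  ext i
  fin_cases i <;> simp [axialRotation]

lemma S2.ext_two_eq_one {θ : S2} (h : (θ : E3) 2 = 1) : θ = northPole := by
  have h1 := S2.sq_sum θ
  rw [h] at h1
  ext i
  fin_cases i <;> simp [northPole]
  · nlinarith [sq_nonneg ((θ : E3) 0), sq_nonneg ((θ : E3) 1)]
  · nlinarith [sq_nonneg ((θ : E3) 0), sq_nonneg ((θ : E3) 1)]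
  · exact h

lemma S2.ext_two_eq_neg_one {θ : S2} (h : (θ : E3) 2 = -1) : θ = southPole := by
  have h1 := S2.sq_sum θ
  rw [h] at h1
  ext i
  fin_cases i <;> simp [southPole]
  · nlinarith [sq_nonneg ((θ : E3) 0), sq_nonneg ((θ : E3) 1)]
  · nlinarith [sq_nonneg ((θ : E3) 0), sq_nonneg ((θ : E3) 1)]
  · exact h

lemma northPole_two : (northPole : E3) 2 = 1 := by simp [northPole]

lemma southPole_two : (southPole : E3) 2 = -1 := by simp [southPole]

lemma southPole_ne_northPole : southPole ≠ northPole := by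
  intro h
  have := northPole_two
  rw [← h, southPole_two] at this
  norm_num at this

lemma axialRotation_northPole (t : ℝ) : axialRotation t northPole = northPole :=
  S2.ext_two_eq_one (by simp [axialRotation, northPole])

lemma axialRotation_southPole (t : ℝ) : axialRotation t southPole = southPole :=
  S2.ext_two_eq_neg_one (by simp [axialRotation, southPole])

lemma rotStereo_two (t : ℝ) (p : ℝ × ℝ) :
    (rotStereo t p : E3) 2 = (1 - sqDist p 0) / (1 + sqDist p 0) := by
  simp [rotStereo_coe]

lemma continuous_rotStereo (t : ℝ) : Continuous (rotStereo t) := by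
  rw [continuous_induced_rng]
  have h : ∀ p : ℝ × ℝ, 1 + sqDist p 0 ≠ 0 := fun p => by linarith [sqDist_nonneg p 0]
  have : (Subtype.val ∘ rotStereo t : ℝ × ℝ → E3) = fun p =>
    !₂[2 * (Real.cos t * p.1 - Real.sin t * p.2) / (1 + sqDist p 0),
      2 * (Real.sin t * p.1 + Real.cos t * p.2) / (1 + sqDist p 0),
      (1 - sqDist p 0) / (1 + sqDist p 0)] := funext fun p => rotStereo_coe t p
  rw [this]
  refine (PiLp.continuous_toLp 2 _).comp (continuous_pi fun i => ?_)
  have hd : Continuous fun p => 1 + sqDist p 0 := by fun_prop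
  fin_cases i
  · exact Continuous.div (by fun_prop) hd h
  · exact Continuous.div (by fun_prop) hd h
  · exact Continuous.div (by fun_prop) hd h

lemma rotStereo_ne_northPole (t : ℝ) {p : ℝ × ℝ} (hp : p ≠ 0) : rotStereo t p ≠ northPole := by
  intro h
  have h1 := rotStereo_two t p
  have hs := sqDist_pos hp
  rw [h, northPole_two, eq_div_iff (by linarith)] at h1
  linarith

lemma rotStereo_zero (t : ℝ) : rotStereo t 0 = northPole :=
  S2.ext_two_eq_one (by rw [rotStereo_two, sqDist_eq_zero.2 rfl]; norm_num)

lemma tendsto_rotStereo_zero (t : ℝ) :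
    Tendsto (rotStereo t) (𝓝[≠] 0) (𝓝[≠] northPole) := by
  refine tendsto_nhdsWithin_iff.2 ⟨?_, ?_⟩
  · exact ((continuous_rotStereo t).tendsto' _ _ (rotStereo_zero t)).mono_left nhdsWithin_le_nhds
  · filter_upwards [self_mem_nhdsWithin] with p hp using rotStereo_ne_northPole t hp

lemma tendsto_sqDist_cocompact : Tendsto (fun p => sqDist p 0) (cocompact (ℝ × ℝ)) atTop := by
  refine tendsto_atTop.2 fun R => ?_
  have h : IsCompact {p | sqDist p 0 ≤ R} :=
    isCompact_of_sqDist_le (isClosed_le (continuous_sqDist 0) continuous_const) fun p hp => hp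
  filter_upwards [h.compl_mem_cocompact] with p hp
  exact (not_le.1 fun h' => hp h').le

lemma dist_rotStereo_southPole (t : ℝ) (p : ℝ × ℝ) :
    dist (rotStereo t p) southPole = Real.sqrt (4 / (1 + sqDist p 0)) := by
  have h : 1 + sqDist p 0 ≠ 0 := by linarith [sqDist_nonneg p 0]
  rw [Subtype.dist_eq, EuclideanSpace.dist_eq, Fin.sum_univ_three, rotStereo_coe]
  congr 1
  simp only [Real.dist_eq, sq_abs, southPole, Matrix.cons_val_zero, Matrix.cons_val_one,
    Matrix.cons_val]
  field_simp
  rw [sqDist_zero]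
  linear_combination 4 * (p.1 ^ 2 + p.2 ^ 2) * Real.sin_sq_add_cos_sq t

lemma tendsto_rotStereo_cocompact (t : ℝ) :
    Tendsto (rotStereo t) (cocompact (ℝ × ℝ)) (𝓝 southPole) := by
  rw [tendsto_iff_dist_tendsto_zero]
  simp only [dist_rotStereo_southPole]
  rw [show (0 : ℝ) = Real.sqrt 0 by simp]
  refine (Real.continuous_sqrt.tendsto 0).comp ?_
  exact (tendsto_atTop_add_const_left _ _ tendsto_sqDist_cocompact).const_div_atTop 4

/-- Angles are measured from the second axis, so that the reflection in the line `x = 0` becomes `a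
↦ -a`. -/
lemma stereoInv_polar (r a : ℝ) :
    stereoInv (r * Real.sin a, r * Real.cos a) = axialRotation (-a) (stereoInv (0, r)) := by
  have hs : sqDist (r * Real.sin a, r * Real.cos a) 0 = r ^ 2 := by
    rw [sqDist_zero]
    linear_combination r ^ 2 * Real.sin_sq_add_cos_sq a
  have hs' : sqDist (0, r) 0 = r ^ 2 := by simp [sqDist_zero]
  ext i
  fin_cases i <;> simp [axialRotation, stereoInv, hs, hs'] <;> ring

lemma exists_polar (p : ℝ × ℝ) :
    ∃ a, p = (Real.sqrt (sqDist p 0) * Real.sin a, Real.sqrt (sqDist p 0) * Real.cos a) := by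
  have hn : ‖(⟨p.2, p.1⟩ : ℂ)‖ = Real.sqrt (sqDist p 0) := by
    rw [Complex.norm_eq_sqrt_sq_add_sq, sqDist_zero, add_comm]
  refine ⟨Complex.arg ⟨p.2, p.1⟩, ?_⟩
  rw [← hn, Complex.norm_mul_cos_arg, Complex.norm_mul_sin_arg]

lemma exists_eq_stereoInv {θ : S2} (h : θ ≠ southPole) : ∃ p, θ = stereoInv p := by
  have h1 := S2.sq_sum θ
  have h2 : 1 + (θ : E3) 2 ≠ 0 := fun h' => h (S2.ext_two_eq_neg_one (by linarith))
  set x := (θ : E3) 0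
  set y := (θ : E3) 1
  set z := (θ : E3) 2 with hz
  have hs : sqDist (x / (1 + z), y / (1 + z)) 0 = (1 - z) / (1 + z) := by
    rw [sqDist_zero]
    field_simp
    linear_combination h1
  have h3 : 1 + (1 - z) / (1 + z) = 2 / (1 + z) := by field_simp; ring
  refine ⟨(x / (1 + z), y / (1 + z)), ?_⟩
  ext i
  fin_cases i
  · simp only [stereoInv, hs, h3]
    simp
    field_simp
    rfl
  · simp only [stereoInv, hs, h3]
    simp
    field_simp
    rfl
  · simp only [stereoInv, hs, h3]
    simp
    field_simp
    rw [← hz]; ring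

lemma IsAxiallySymmetric.apply_rotStereo {K : S2 → ℝ} (hK : IsAxiallySymmetric K) (t : ℝ)
    (p : ℝ × ℝ) : K (rotStereo t p) = K (stereoInv (0, Real.sqrt (sqDist p 0))) := by
  obtain ⟨a, ha⟩ := exists_polar p
  rw [rotStereo, hK]
  conv_lhs => rw [ha]
  rw [stereoInv_polar, hK]

lemma rotStereo_zero_eq (p : ℝ × ℝ) : rotStereo 0 p = stereoInv p := axialRotation_zero _

lemma IncreasesTowardNorth.apply_le {K : S2 → ℝ} (hK : IsAxiallySymmetric K)
    (hinc : IncreasesTowardNorth K) (t : ℝ) {p p' : ℝ × ℝ} (hp : p ≠ 0)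
    (h : sqDist p 0 ≤ sqDist p' 0) : K (rotStereo t p') ≤ K (rotStereo t p) := by
  rcases h.eq_or_lt with h | h
  · rw [hK.apply_rotStereo, hK.apply_rotStereo t p, h]
  have hs := sqDist_pos hp
  have hsq : ∀ r : ℝ, sqDist (0, r) 0 = r ^ 2 := fun r => by simp [sqDist_zero]
  rw [hK.apply_rotStereo, hK.apply_rotStereo t p]
  have hne : ∀ s : ℝ, 0 < s → stereoInv (0, Real.sqrt s) ≠ northPole := fun s hs => by
    rw [← rotStereo_zero_eq]
    refine rotStereo_ne_northPole 0 fun h' => ?_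
    have := (Real.sqrt_pos.2 hs).ne'
    simp_all
  refine hinc _ _ (hne _ hs) (hne _ (hs.trans h)) ⟨Real.pi / 2, ?_, ?_⟩ ?_
  · simp [stereoInv]
  · simp [stereoInv]
  · rw [← rotStereo_zero_eq, ← rotStereo_zero_eq, rotStereo_two, rotStereo_two, hsq, hsq,
      Real.sq_sqrt (sqDist_nonneg _ _), Real.sq_sqrt (sqDist_nonneg _ _),
      div_lt_div_iff₀ (by linarith) (by linarith)]
    nlinarith

lemma IncreasesTowardNorth.southPole_le {K : S2 → ℝ} (hinc : IncreasesTowardNorth K) {θ : S2}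
    (hθ : θ ≠ northPole) : K southPole ≤ K θ := by
  rcases eq_or_ne θ southPole with rfl | h
  · exact le_rfl
  obtain ⟨a, ha⟩ := exists_polar ((θ : E3) 1, (θ : E3) 0)
  rw [Prod.mk.injEq] at ha
  refine hinc _ _ hθ southPole_ne_northPole ⟨a, ?_, ?_⟩ ?_
  · linear_combination Real.cos a * ha.1 - Real.sin a * ha.2
  · simp [southPole]
  · rw [southPole_two]
    have h1 := S2.sq_sum θ
    refine lt_of_le_of_ne ?_ fun h' => h (S2.ext_two_eq_neg_one h'.symm)
    nlinarith [sq_nonneg ((θ : E3) 0), sq_nonneg ((θ : E3) 1)]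

lemma geoDist_northPole (θ : S2) : geoDist θ northPole = Real.arccos ((θ : E3) 2) := by
  unfold geoDist
  simp [PiLp.inner_apply, Fin.sum_univ_three, northPole]

/-- The sine of the geodesic distance is `2|p| / (1 + |p|²)`, which is at least `|p|` when `|p| ≤
1`. This transfers the logarithmic lower bound to the plane. -/
lemma sqrt_sqDist_le_geoDist (t : ℝ) {p : ℝ × ℝ} (hp : sqDist p 0 ≤ 1) :
    Real.sqrt (sqDist p 0) ≤ geoDist (rotStereo t p) northPole := by
  rw [geoDist_northPole, rotStereo_two]
  refine le_trans ?_ (Real.sin_le (Real.arccos_nonneg _))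
  rw [Real.sin_arccos]
  apply Real.sqrt_le_sqrt
  have h0 := sqDist_nonneg p 0
  set s := sqDist p 0
  have h1 : 1 - ((1 - s) / (1 + s)) ^ 2 = 4 * s / (1 + s) ^ 2 := by
    field_simp; ring
  rw [h1, le_div_iff₀ (by positivity)]
  have : (1 + s) ^ 2 ≤ 4 := by nlinarith
  nlinarith

/-! ### From the sphere to the punctured plane -/

lemma isPlanarSolution_rotStereo {K f v : S2 → ℝ}
    (hKc : ContinuousOn K {northPole}ᶜ)
    (hK0 : ∀ θ, θ ≠ northPole → 0 ≤ K θ) (hf0 : ∀ θ, θ ≠ northPole → 0 ≤ f θ)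
    (hKs : IsAxiallySymmetric K) (hfs : IsAxiallySymmetric f)
    (hKi : IncreasesTowardNorth K) (hfi : IncreasesTowardNorth f)
    (hne : ¬ ((∀ θ, θ ≠ northPole → f θ = 0) ∧ ∃ a, ∀ θ, θ ≠ northPole → K θ = a))
    (hv : ContMDiffOn (𝓡 2) 𝓘(ℝ, ℝ) 2 v {northPole}ᶜ)
    (heq : ∀ θ, θ ≠ northPole → -sphereLaplacian v θ + 1 = K θ * Real.exp (2 * v θ) + f θ)
    (hlow : ∀ ε > 0, ∀ᶠ θ in 𝓝[≠] northPole, ε * Real.log (geoDist θ northPole) ≤ v θ)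
    (t : ℝ) :
    IsPlanarSolution (fun p => v (rotStereo t p) - Real.log (sqDist p 0 + 1))
      (fun p => 4 * K (rotStereo t p)) (fun p => 4 / (1 + sqDist p 0) ^ 2 * f (rotStereo t p)) := by
  have hpos : ∀ p : ℝ × ℝ, 0 < 1 + sqDist p 0 := fun p => by linarith [sqDist_nonneg p 0]
  have hvc : ContinuousOn v {northPole}ᶜ := hv.continuousOn
  have hexp : ∀ p : ℝ × ℝ, Real.exp (2 * (v (rotStereo t p) - Real.log (sqDist p 0 + 1))) =
      Real.exp (2 * v (rotStereo t p)) / (1 + sqDist p 0) ^ 2 := by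
    intro p
    rw [mul_sub, Real.exp_sub, two_mul (Real.log _), Real.exp_add,
      Real.exp_log (by linarith [hpos p]), add_comm (sqDist p 0), sq]
  have hrefl : ∀ l > 0, ∀ p ∈ puncturedHalfPlane l, sqDist p 0 < sqDist (reflect l p) 0 := by
    intro l hl p hp
    rw [sqDist_reflect]
    have := mul_pos hl (sub_pos.2 hp.1)
    linarith
  refine ⟨?_, ?_, ?_, ?_, ?_, ?_, ?_, ?_, ?_, ?_⟩
  · have h1 : ContinuousOn (fun p => v (rotStereo t p)) {0}ᶜ :=
      hvc.comp (continuous_rotStereo t).continuousOn fun p hp => rotStereo_ne_northPole t hp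
    have h2 : Continuous fun p => Real.log (sqDist p 0 + 1) :=
      Continuous.log (by fun_prop) fun p => by linarith [hpos p]
    exact h1.sub h2.continuousOn
  · intro p hp
    have hθ := rotStereo_ne_northPole t hp
    have h1 := hasLaplacianAt_comp_rotStereo t
      (hv.contMDiffAt (isOpen_compl_singleton.mem_nhds hθ))
    have h2 := h1.sub (hasLaplacianAt_log (c := 1) (p := p) (by linarith [hpos p]))
    convert h2 using 1
    rw [hexp, add_comm (sqDist p 0)]
    have h3 := heq _ hθ
    have := (hpos p).ne'
    field_simp
    linear_combination h3
  · intro p hp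
    have := hK0 _ (rotStereo_ne_northPole t hp)
    positivity
  · intro p hp
    have := hf0 _ (rotStereo_ne_northPole t hp)
    positivity
  · intro l hl p hp
    have := hKi.apply_le hKs t hp.2 (hrefl l hl p hp).le
    linarith
  · intro l hl p hp
    have h1 := hfi.apply_le hfs t hp.2 (hrefl l hl p hp).le
    have h2 := hf0 _ (rotStereo_ne_northPole t (reflect_ne_zero hl hp.1.le))
    have h3 := hrefl l hl p hp
    have := hpos p
    gcongr
  · intro l hl
    -- The half-plane `x ≥ l` lies over this closed cap, which misses the north pole, so `K e^{2v}`
    -- is bounded there.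
    have hc : IsCompact {θ : S2 | (θ : E3) 2 ≤ (1 - l ^ 2) / (1 + l ^ 2)} := by
      refine IsClosed.isCompact (isClosed_le ?_ continuous_const)
      fun_prop
    have hsub : {θ : S2 | (θ : E3) 2 ≤ (1 - l ^ 2) / (1 + l ^ 2)} ⊆ {northPole}ᶜ := by
      rintro θ hθ rfl
      have h1 : (northPole : E3) 2 ≤ (1 - l ^ 2) / (1 + l ^ 2) := hθ
      rw [northPole_two, le_div_iff₀ (by positivity)] at h1
      nlinarith
    have hcont : ContinuousOn (fun θ => K θ * Real.exp (2 * v θ)) {northPole}ᶜ :=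
      hKc.mul (Real.continuous_exp.comp_continuousOn (continuousOn_const.mul hvc))
    obtain ⟨C, hC⟩ := hc.bddAbove_image (hcont.mono hsub)
    refine ⟨4 * C, fun p hp => ?_⟩
    have hp0 : p ≠ 0 := ne_zero_of_fst_pos (hl.trans_le hp)
    have hmem : (rotStereo t p : E3) 2 ≤ (1 - l ^ 2) / (1 + l ^ 2) := by
      have : l ^ 2 ≤ sqDist p 0 := by rw [sqDist_zero]; nlinarith [sq_nonneg p.2]
      rw [rotStereo_two, div_le_div_iff₀ (hpos p) (by positivity)]
      nlinarith
    have h1 : K (rotStereo t p) * Real.exp (2 * v (rotStereo t p)) ≤ C :=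
      hC (mem_image_of_mem _ hmem)
    have h2 : 0 ≤ K (rotStereo t p) * Real.exp (2 * v (rotStereo t p)) :=
      mul_nonneg (hK0 _ (rotStereo_ne_northPole t hp0)) (Real.exp_pos _).le
    have h3 : sqDist p 0 ^ 2 / (1 + sqDist p 0) ^ 2 ≤ 1 := by
      rw [div_le_one (by have := hpos p; positivity)]
      have := sqDist_nonneg p 0
      gcongr
      linarith
    rw [hexp]
    calc 4 * K (rotStereo t p) * (Real.exp (2 * v (rotStereo t p)) / (1 + sqDist p 0) ^ 2) *
          sqDist p 0 ^ 2
        = 4 * ((K (rotStereo t p) * Real.exp (2 * v (rotStereo t p))) *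
          (sqDist p 0 ^ 2 / (1 + sqDist p 0) ^ 2)) := by ring
      _ ≤ 4 * (K (rotStereo t p) * Real.exp (2 * v (rotStereo t p))) := by
          exact mul_le_mul_of_nonneg_left (mul_le_of_le_one_right h2 h3) (by norm_num)
      _ ≤ 4 * C := by gcongr
  · intro ε hε
    have hsmall : ∀ᶠ p in 𝓝[≠] (0 : ℝ × ℝ), sqDist p 0 < 1 := by
      refine nhdsWithin_le_nhds ((continuous_sqDist 0).continuousAt.eventually
        (gt_mem_nhds ?_))
      simp [sqDist]
    filter_upwards [(tendsto_rotStereo_zero t).eventually (hlow ε hε), hsmall,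
      self_mem_nhdsWithin,
      tendsto_log_sqDist.eventually (eventually_le_atBot (-(2 / ε) * Real.log 2))] with p h1 h2 h3 h4
    have hs := sqDist_pos h3
    have h5 := Real.log_le_log (Real.sqrt_pos.2 hs) (sqrt_sqDist_le_geoDist t h2.le)
    rw [Real.log_sqrt hs.le] at h5
    have h6 := mul_le_mul_of_nonneg_left h5 hε.le
    have h7 : Real.log (sqDist p 0 + 1) ≤ Real.log 2 :=
      Real.log_le_log (by linarith) (by linarith)
    have h8 := mul_le_mul_of_nonneg_left h4 (half_pos hε).le
    have h9 : ε / 2 * (-(2 / ε) * Real.log 2) = -Real.log 2 := by field_simp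
    linarith
  · refine ⟨v southPole, ?_⟩
    have h1 : ContinuousAt v southPole :=
      hvc.continuousAt (isOpen_compl_singleton.mem_nhds southPole_ne_northPole)
    refine (h1.tendsto.comp (tendsto_rotStereo_cocompact t)).congr fun p => ?_
    rw [add_comm (1 : ℝ)]
    simp
  · intro l hl
    -- Symmetry of both coefficients in a single line `x = l` already forces `f = 0` and `K`
    -- constant. Points of the negative first axis meet every latitude other than the poles.
    by_contra! hall
    have hP : ∀ ρ > 0, ((-ρ, 0) : ℝ × ℝ) ∈ puncturedHalfPlane l := fun ρ hρ =>
      ⟨by simp only; linarith, fun h => by simp at h; linarith⟩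
    have hs : ∀ ρ : ℝ, sqDist (-ρ, 0) 0 = ρ ^ 2 := fun ρ => by simp [sqDist_zero]
    have hfθ : ∀ ρ > 0, f (rotStereo t (-ρ, 0)) = 0 := by
      intro ρ hρ
      have h1 := (hall _ (hP ρ hρ)).2
      have h2 := hfi.apply_le hfs t (hP ρ hρ).2 (hrefl l hl _ (hP ρ hρ)).le
      have h3 := hf0 _ (rotStereo_ne_northPole t (hP ρ hρ).2)
      have h4 := hrefl l hl _ (hP ρ hρ)
      -- The weight in `F` strictly decreases under the reflection while `f` does not increase, so
      -- equality of `F` is possible only if `f` vanishes.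
      have h5 : 4 / (1 + sqDist (reflect l (-ρ, 0)) 0) ^ 2 < 4 / (1 + sqDist (-ρ, 0) 0) ^ 2 := by
        have := hpos (-ρ, 0)
        gcongr
      have h6 : 0 ≤ 4 / (1 + sqDist (reflect l (-ρ, 0)) 0) ^ 2 := by positivity
      by_contra h7
      have h8 : 0 < f (rotStereo t (-ρ, 0)) := h3.lt_of_ne' h7
      nlinarith [mul_le_mul_of_nonneg_left h2 h6, mul_pos (sub_pos.2 h5) h8]
    have hrad : ∀ θ, θ ≠ northPole → θ ≠ southPole → ∃ ρ > 0,
        ∀ G : S2 → ℝ, IsAxiallySymmetric G → G θ = G (rotStereo t (-ρ, 0)) := by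
      intro θ hn hs'
      obtain ⟨p, rfl⟩ := exists_eq_stereoInv hs'
      have hp : p ≠ 0 := by
        rintro rfl
        exact hn (by rw [← rotStereo_zero_eq, rotStereo_zero])
      refine ⟨Real.sqrt (sqDist p 0), Real.sqrt_pos.2 (sqDist_pos hp), fun G hG => ?_⟩
      rw [hG.apply_rotStereo, hs, Real.sq_sqrt (sqDist_nonneg _ _), ← rotStereo_zero_eq,
        hG.apply_rotStereo]
    -- The radial profile of `K` has period `2l`; being monotone as well, it is constant.
    have hKper : ∀ ρ > 0, K (rotStereo t (-(ρ + 2 * l), 0)) = K (rotStereo t (-ρ, 0)) := by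
      intro ρ hρ
      have h1 := (hall _ (hP ρ hρ)).1
      have h2 : K (rotStereo t (-(ρ + 2 * l), 0)) = K (rotStereo t (reflect l (-ρ, 0))) := by
        rw [hKs.apply_rotStereo, hKs.apply_rotStereo t (reflect _ _), hs]
        congr 4
        simp only [reflect, sqDist_zero]
        ring
      linarith
    have hKanti : ∀ ρ > 0, ∀ ρ' ≥ ρ, K (rotStereo t (-ρ', 0)) ≤ K (rotStereo t (-ρ, 0)) := by
      intro ρ hρ ρ' hρ'
      refine hKi.apply_le hKs t (hP ρ hρ).2 ?_
      rw [hs, hs]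
      gcongr
    have hKiter : ∀ n : ℕ, ∀ ρ > 0,
        K (rotStereo t (-(ρ + n * (2 * l)), 0)) = K (rotStereo t (-ρ, 0)) := by
      intro n ρ hρ
      induction n with
      | zero => simp
      | succ n ih =>
        rw [← ih, ← hKper (ρ + n * (2 * l)) (by positivity)]
        congr 4
        push_cast
        ring
    have hKconst : ∀ ρ > 0, K (rotStereo t (-ρ, 0)) = K (rotStereo t (-1, 0)) := by
      have hle : ∀ ρ > 0, ∀ ρ' > 0, K (rotStereo t (-ρ, 0)) ≤ K (rotStereo t (-ρ', 0)) := by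
        intro ρ hρ ρ' hρ'
        obtain ⟨n, hn⟩ := exists_nat_ge (ρ' / (2 * l))
        rw [div_le_iff₀ (by positivity)] at hn
        rw [← hKiter n ρ hρ]
        exact hKanti ρ' hρ' _ (by linarith)
      exact fun ρ hρ => le_antisymm (hle ρ hρ 1 one_pos) (hle 1 one_pos ρ hρ)
    have hKsouth : K southPole = K (rotStereo t (-1, 0)) := by
      have h1 : ContinuousAt K southPole :=
        hKc.continuousAt (isOpen_compl_singleton.mem_nhds southPole_ne_northPole)
      have h2 : Tendsto (fun ρ : ℝ => ((-ρ, 0) : ℝ × ℝ)) atTop (cocompact (ℝ × ℝ)) := by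
        rw [← Metric.cobounded_eq_cocompact, ← tendsto_norm_atTop_iff_cobounded]
        refine tendsto_atTop_mono (fun ρ => ?_) tendsto_id
        rw [Prod.norm_def]
        exact (le_abs_self ρ).trans (by simp)
      have h3 := h1.tendsto.comp ((tendsto_rotStereo_cocompact t).comp h2)
      refine tendsto_nhds_unique h3 (tendsto_const_nhds.congr' ?_)
      filter_upwards [eventually_gt_atTop 0] with ρ hρ using (hKconst ρ hρ).symm
    refine hne ⟨fun θ hθ => ?_, K (rotStereo t (-1, 0)), fun θ hθ => ?_⟩
    · have hz : ∀ θ, θ ≠ northPole → θ ≠ southPole → f θ = 0 := fun θ h1 h2 => by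
        obtain ⟨ρ, hρ, hG⟩ := hrad θ h1 h2
        rw [hG f hfs, hfθ ρ hρ]
      rcases eq_or_ne θ southPole with rfl | h
      · refine le_antisymm ?_ (hf0 _ hθ)
        exact (hfi.southPole_le (rotStereo_ne_northPole t (hP 1 one_pos).2)).trans
          (hfθ 1 one_pos).le
      · exact hz θ hθ h
    · rcases eq_or_ne θ southPole with rfl | h
      · exact hKsouth
      · obtain ⟨ρ, hρ, hG⟩ := hrad θ hθ h
        rw [hG K hKs, hKconst ρ hρ]

/-! ### Rotational symmetry on the sphere -/

/-- The symmetry theorem, under the weaker assumption that `f` does not vanish identically or `K`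
is not constant. -/
theorem isAxiallySymmetric_of_equation {K f v : S2 → ℝ}
    (hKc : ContinuousOn K {northPole}ᶜ)
    (hK0 : ∀ θ, θ ≠ northPole → 0 ≤ K θ) (hf0 : ∀ θ, θ ≠ northPole → 0 ≤ f θ)
    (hKs : IsAxiallySymmetric K) (hfs : IsAxiallySymmetric f)
    (hKi : IncreasesTowardNorth K) (hfi : IncreasesTowardNorth f)
    (hne : ¬ ((∀ θ, θ ≠ northPole → f θ = 0) ∧ ∃ a, ∀ θ, θ ≠ northPole → K θ = a))
    (hv : ContMDiffOn (𝓡 2) 𝓘(ℝ, ℝ) 2 v {northPole}ᶜ)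
    (heq : ∀ θ, θ ≠ northPole → -sphereLaplacian v θ + 1 = K θ * Real.exp (2 * v θ) + f θ)
    (hlow : ∀ ε > 0, ∀ᶠ θ in 𝓝[≠] northPole, ε * Real.log (geoDist θ northPole) ≤ v θ) :
    IsAxiallySymmetric v := by
  have hsol := isPlanarSolution_rotStereo hKc hK0 hf0 hKs hfs hKi hfi hne hv heq hlow
  -- The limiting comparison `l = 0` in the chart turned by `φ`, read along a circle of latitude.
  have hsin : ∀ r > 0, ∀ φ a : ℝ, Real.sin a < 0 →
      v (axialRotation (φ + a) (stereoInv (0, r))) ≤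
        v (axialRotation (φ - a) (stereoInv (0, r))) := by
    intro r hr φ a ha
    have h1 := (hsol φ).reflect_zero_le (p := (r * Real.sin a, r * Real.cos a))
      (mul_neg_of_pos_of_neg hr ha)
    have h2 : reflect 0 (r * Real.sin a, r * Real.cos a) =
        (r * Real.sin (-a), r * Real.cos (-a)) := by
      simp [reflect]
    rw [sqDist_reflect] at h1
    simp only [mul_zero, zero_mul, add_zero] at h1
    rw [h2, rotStereo, rotStereo, stereoInv_polar, stereoInv_polar, axialRotation_axialRotation,
      axialRotation_axialRotation, neg_neg] at h1
    rw [sub_eq_add_neg]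
    linarith
  have hper : ∀ β : ℝ, ∀ θ, axialRotation (β + 2 * Real.pi) θ = axialRotation β θ := by
    intro β θ
    ext i
    fin_cases i <;> simp [axialRotation]
  -- Any two angles are `φ ± a`, with `φ` their mean and `a` half their difference. If `sin a > 0`,
  -- shifting both `φ` and `a` by `π` reverses the sign of the sine and leaves the two points
  -- unchanged.
  have hle : ∀ r > 0, ∀ β β' : ℝ, v (axialRotation β (stereoInv (0, r))) ≤
      v (axialRotation β' (stereoInv (0, r))) := by
    intro r hr β β'
    rcases lt_trichotomy (Real.sin ((β - β') / 2)) 0 with h | h | h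
    · have := hsin r hr ((β + β') / 2) ((β - β') / 2) h
      convert this using 3 <;> ring
    · obtain ⟨n, hn⟩ := Real.sin_eq_zero_iff.1 h
      have h1 : β = β' + n * (2 * Real.pi) := by linarith
      refine le_of_eq (congrArg v ?_)
      rw [h1]
      ext i
      fin_cases i <;> simp [axialRotation]
    · have := hsin r hr ((β + β') / 2 + Real.pi) ((β - β') / 2 + Real.pi)
        (by rw [Real.sin_add_pi]; linarith)
      rw [← hper β]
      convert this using 3 <;> ring
  intro s θ
  rcases eq_or_ne θ southPole with rfl | hθ
  · rw [axialRotation_southPole]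
  obtain ⟨p, rfl⟩ := exists_eq_stereoInv hθ
  rcases eq_or_ne p 0 with rfl | hp
  · rw [← rotStereo_zero_eq, rotStereo_zero, axialRotation_northPole]
  obtain ⟨a, ha⟩ := exists_polar p
  have hr := Real.sqrt_pos.2 (sqDist_pos hp)
  rw [ha, stereoInv_polar, axialRotation_axialRotation]
  exact le_antisymm (hle _ hr _ _) (hle _ hr _ _)

/-! ### The growth condition at the north pole and the mean field equation -/

lemma tendsto_log_geoDist :
    Tendsto (fun θ => Real.log (geoDist θ northPole)) (𝓝[≠] northPole) atBot := by
  refine Real.tendsto_log_nhdsGT_zero.comp (tendsto_nhdsWithin_iff.2 ⟨?_, ?_⟩)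
  · have hc : Continuous fun θ : S2 => geoDist θ northPole := by
      simp only [geoDist_northPole]
      exact Real.continuous_arccos.comp (by fun_prop)
    have := hc.tendsto northPole
    rw [geoDist_northPole, northPole_two, Real.arccos_one] at this
    exact this.mono_left nhdsWithin_le_nhds
  · filter_upwards [self_mem_nhdsWithin] with θ hθ
    rw [mem_Ioi, geoDist_northPole, Real.arccos_pos]
    refine lt_of_le_of_ne ?_ fun h => hθ (S2.ext_two_eq_one h)
    nlinarith [S2.sq_sum θ, sq_nonneg ((θ : E3) 0), sq_nonneg ((θ : E3) 1)]

/-- Near the pole the logarithm is negative, so an upper bound on the quotient becomes a lower bound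
on `v`. -/
lemma eventually_le_of_limsup_div_log_le {v : S2 → ℝ}
    (h : Filter.limsup (fun θ => ((v θ / Real.log (geoDist θ northPole) : ℝ) : EReal))
      (𝓝[≠] northPole) ≤ 0) {ε : ℝ} (hε : 0 < ε) :
    ∀ᶠ θ in 𝓝[≠] northPole, ε * Real.log (geoDist θ northPole) ≤ v θ := by
  have h1 : Filter.limsup (fun θ => ((v θ / Real.log (geoDist θ northPole) : ℝ) : EReal))
      (𝓝[≠] northPole) < (ε : EReal) := h.trans_lt (by exact_mod_cast hε)
  filter_upwards [eventually_lt_of_limsup_lt h1,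
    tendsto_log_geoDist.eventually (eventually_lt_atBot 0)] with θ h2 h3
  have h4 : v θ / Real.log (geoDist θ northPole) < ε := by exact_mod_cast h2
  rw [div_lt_iff_of_neg h3] at h4
  exact h4.le

lemma ContinuousAt.eventually_mul_log_geoDist_le {v : S2 → ℝ} (h : ContinuousAt v northPole)
    {ε : ℝ} (hε : 0 < ε) :
    ∀ᶠ θ in 𝓝[≠] northPole, ε * Real.log (geoDist θ northPole) ≤ v θ := by
  filter_upwards [nhdsWithin_le_nhds (h.eventually (lt_mem_nhds (sub_one_lt (v northPole)))),
    (tendsto_log_geoDist.const_mul_atBot hε).eventually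
      (eventually_le_atBot (v northPole - 1))] with θ h1 h2
  linarith

lemma sphereLaplacian_const_mul {v : S2 → ℝ} {θ : S2} (hv : ContMDiffAt (𝓡 2) 𝓘(ℝ, ℝ) 2 v θ)
    (c : ℝ) : sphereLaplacian (fun σ => c * v σ) θ = c * sphereLaplacian v θ := by
  have h : radialExtension (fun σ => c * v σ) = c • radialExtension v := by
    funext x
    by_cases hx : x = 0 <;> simp [radialExtension, hx]
  rw [sphereLaplacian, h,
    InnerProductSpace.laplacian_smul c (contDiffAt_radialExtension hv), smul_eq_mul,
    sphereLaplacian]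

lemma inner_southPole (θ : S2) : ⟪(southPole : E3), (θ : E3)⟫ = -(θ : E3) 2 := by
  simp [PiLp.inner_apply, Fin.sum_univ_three, southPole]

/-- Solutions of the subcritical mean field equation are axially symmetric. -/
theorem isAxiallySymmetric_of_meanField {α γ : ℝ} {φ : S2 → ℝ} (hα : 0 < α)
    (hα8 : α < 8 * Real.pi) (hγ : 0 ≤ γ) (hφ : ContMDiff (𝓡 2) 𝓘(ℝ, ℝ) 2 φ) {I : ℝ} (hI : 0 ≤ I)
    (heq : ∀ θ, sphereLaplacian φ θ
      + Real.exp (α * φ θ - γ * ⟪(southPole : E3), (θ : E3)⟫) / I - 1 / (4 * Real.pi) = 0) :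
    IsAxiallySymmetric φ := by
  have hv : ContMDiff (𝓡 2) 𝓘(ℝ, ℝ) 2 fun θ => α / 2 * φ θ :=
    (contDiff_const.mul contDiff_id : ContDiff ℝ 2 fun x : ℝ => α / 2 * x).contMDiff.comp hφ
  have hf : 0 < 1 - α / (8 * Real.pi) := sub_pos.2 ((div_lt_one (by positivity)).2 hα8)
  have key : IsAxiallySymmetric fun θ => α / 2 * φ θ := by
    -- Multiplying the equation by `-α/2` and adding 1 gives these `K` and `f`. As `⟨s, θ⟩ = -θ₃`,
    -- the sign of `γ` makes `K` increase toward the north pole, and `α < 8π` makes `f` positive, so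
    -- nondegeneracy holds whatever `K` is.
    refine isAxiallySymmetric_of_equation
      (K := fun θ => α / 2 / I * Real.exp (γ * (θ : E3) 2))
      (f := fun _ => 1 - α / (8 * Real.pi)) ?_ (fun θ _ => by positivity) (fun _ _ => hf.le) ?_
      (fun _ _ => rfl) ?_ (fun _ _ _ _ _ _ => le_rfl)
      (fun h => hf.ne' (h.1 southPole southPole_ne_northPole)) hv.contMDiffOn ?_
      (fun ε hε => hv.continuous.continuousAt.eventually_mul_log_geoDist_le hε)
    · exact Continuous.continuousOn (by fun_prop)
    · intro t θ
      simp [axialRotation]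
    · intro θ θ' _ _ _ h
      simp only
      gcongr
    · intro θ _
      have h1 := heq θ
      rw [inner_southPole] at h1
      rw [sphereLaplacian_const_mul hφ.contMDiffAt]
      have h2 : α / 2 / I * Real.exp (γ * (θ : E3) 2) * Real.exp (2 * (α / 2 * φ θ)) =
          α / 2 * (Real.exp (α * φ θ - γ * -(θ : E3) 2) / I) := by
        rw [mul_assoc, ← Real.exp_add,
          show γ * (θ : E3) 2 + 2 * (α / 2 * φ θ) = α * φ θ - γ * -(θ : E3) 2 by ring]
        ring
      have h3 : α / (8 * Real.pi) = α / 2 * (1 / (4 * Real.pi)) := by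
        field_simp
        norm_num
      rw [h2, h3]
      linear_combination -(α / 2) * h1
  intro t θ
  have h := key t θ
  simp only at h
  exact mul_left_cancel₀ (by positivity) h

theorem theorem1p7 :
    (∀ K f v : S2 → ℝ,
      ContinuousOn K {northPole}ᶜ → ContinuousOn f {northPole}ᶜ →
      (∀ θ, θ ≠ northPole → 0 ≤ K θ) → (∀ θ, θ ≠ northPole → 0 ≤ f θ) →
      IsAxiallySymmetric K → IsAxiallySymmetric f →
      IncreasesTowardNorth K → IncreasesTowardNorth f →
      (¬ ∃ a b : ℝ, ∀ θ, θ ≠ northPole → K θ = a ∧ f θ = b) →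
      ContMDiffOn (𝓡 2) 𝓘(ℝ, ℝ) 2 v {northPole}ᶜ →
      (∀ θ, θ ≠ northPole →
        -sphereLaplacian v θ + 1 = K θ * Real.exp (2 * v θ) + f θ) →
      Filter.limsup (fun θ => ((v θ / Real.log (geoDist θ northPole) : ℝ) : EReal))
        (𝓝[≠] northPole) ≤ 0 →
      IsAxiallySymmetric v) ∧
    (∀ (α γ : ℝ) (φ : S2 → ℝ),
      0 < α → α < 8 * Real.pi → 0 ≤ γ →
      ContMDiff (𝓡 2) 𝓘(ℝ, ℝ) 2 φ →
      (∀ θ, sphereLaplacian φ θ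
          + Real.exp (α * φ θ - γ * ⟪(southPole : E3), (θ : E3)⟫)
            / (∫ σ, Real.exp (α * φ σ - γ * ⟪(southPole : E3), (σ : E3)⟫) ∂surfaceMeasure)
          - 1 / (4 * Real.pi) = 0) →
      IsAxiallySymmetric φ) := by
  refine ⟨fun K f v hKc _ hK0 hf0 hKs hfs hKi hfi hne hv heq hlim => ?_,
    fun α γ φ hα hα8 hγ hφ heq => ?_⟩
  · refine isAxiallySymmetric_of_equation hKc hK0 hf0 hKs hfs hKi hfi ?_ hv heq
      fun ε hε => eventually_le_of_limsup_div_log_le hlim hε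
    rintro ⟨hf, a, ha⟩
    exact hne ⟨a, 0, fun θ hθ => ⟨ha θ hθ, hf θ hθ⟩⟩
  · exact isAxiallySymmetric_of_meanField hα hα8 hγ hφ
      (integral_nonneg fun σ => (Real.exp_pos _).le) heq
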